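/- Let $k>0$ and let $1,\delta,\bar\delta$ denote the trivial character, $\det$ and $\overline{\det}$ of $GL_k(\mathbb C)$. For characters $\chi_1,\chi_2$ of $GL_k(\mathbb C)$ let $\chi_1\times\chi_2$ be the representation of $G=GL_{2k}(\mathbb C)$ by right translations $(R_gf)(x)=f(xg)$ on the space of smooth functions $f:G\to\mathbb C$ with $$f(yx)=\chi_1(a)\,\chi_2(d)\,\Bigl(\frac{|\det a|^{2k}}{|\det d|^{2k}}\Bigr)^{1/2}f(x)\qquad\text{for all } x\in G,\ y=\begin{pmatrix}a&b\\0&d\end{pmatrix}\in G,\ a,d\in GL_k(\mathbb C),$$ with the usual $C^\infty$ topology (uniform convergence of all derivatives on compact sets). For a complex $k\times k$ matrix $z$ and a smooth function $f$ on $G$ put $$(L_zf)(x)=\frac{d}{dt}\Big|_{t=0}f\left(\begin{pmatrix}1&0\\-tz&1\end{pmatrix}x\right),$$ and, with $E_{rs}$ the matrix units, let $\partial_{rs}=\tfrac12(L_{E_{rs}}-\sqrt{-1}\,L_{\sqrt{-1}E_{rs}})$ and $\bar\partial_{rs}=\tfrac12(L_{E_{rs}}+\sqrt{-1}\,L_{\sqrt{-1}E_{rs}})$.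 These operators commute with each other; let $\det(\partial)$ and $\det(\bar\partial)$ be the determinants of the matrices $(\partial_{rs})$ and $(\bar\partial_{rs})$. Then for all integers $i>0$ and all integers $j$ there are nonzero continuous linear $G$-intertwining operators $$1\times\delta^i\bar\delta^j\longrightarrow\delta^i\times\bar\delta^j,\qquad 1\times\bar\delta^i\delta^j\longrightarrow\bar\delta^i\times\delta^j,$$ given by $f\mapsto\det(\partial)^if$ and $f\mapsto\det(\bar\partial)^if$ respectively. -/

import Mathlib

open scoped ContDiff

noncomputable section

namespace LineBundleGr

section SmoothFunctions

/- A norm on the finite-dimensional real vector space of complex matrices. Only its topology and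
the boundedness notions it defines matter, so that any other norm would do. -/
attribute [local instance] Matrix.normedAddCommGroup Matrix.normedSpace

variable {n : Type} [Fintype n] [DecidableEq n]

/-- `GL_n(ℂ)` as an open subset of the space of all matrices. -/
def glSet (n : Type) [Fintype n] [DecidableEq n] : Set (Matrix n n ℂ) := {x | IsUnit x}

open Classical in
/-- Extension by zero of a function on `GL_n(ℂ)` to the space of all matrices. It is only ever
looked at on the open set `glSet n`. -/
def ext (f : GL n ℂ → ℂ) (x : Matrix n n ℂ) : ℂ :=
  if h : IsUnit x then f h.unit else 0

theorem ext_val (f : GL n ℂ → ℂ) (g : GL n ℂ) : ext f (g : Matrix n n ℂ) = f g := by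
  have h : IsUnit (g : Matrix n n ℂ) := g.isUnit
  rw [ext, dif_pos h]
  exact congrArg f (Units.ext rfl)

theorem ext_translate (f : GL n ℂ → ℂ) (g : GL n ℂ) :
    ext (fun x => f (x * g)) = fun x => ext f (x * (g : Matrix n n ℂ)) := by
  funext x
  by_cases h : IsUnit x
  · obtain ⟨u, rfl⟩ := h
    rw [ext_val, ← Units.val_mul, ext_val]
  · have h' : ¬ IsUnit (x * (g : Matrix n n ℂ)) := by
      rwa [Units.isUnit_mul_units]
    rw [ext, dif_neg h, ext, dif_neg h']

/-- Smooth functions on the real manifold `GL_n(ℂ)`, an open set of matrices: all real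
derivatives of all orders exist. -/
def IsSmooth (f : GL n ℂ → ℂ) : Prop := ContDiffOn ℝ ∞ (ext f) (glSet n)

theorem IsSmooth.translate {f : GL n ℂ → ℂ} (hf : IsSmooth f) (g : GL n ℂ) :
    IsSmooth fun x => f (x * g) := by
  unfold IsSmooth at *
  rw [ext_translate]
  refine ContDiffOn.comp (g := ext f) (f := fun x => x * (g : Matrix n n ℂ)) hf ?_ ?_
  · have h : ContDiff ℝ ∞ fun x : Matrix n n ℂ => x * (g : Matrix n n ℂ) :=
      (LinearMap.toContinuousLinearMap
        (LinearMap.mulRight ℝ (g : Matrix n n ℂ))).contDiff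
    exact h.contDiffOn
  · intro x hx
    exact (Units.isUnit_mul_units x g).2 hx

variable (n) in
/-- The smooth functions as a subspace of all functions. -/
def smoothSubmodule : Submodule ℂ (GL n ℂ → ℂ) where
  carrier := {f | IsSmooth f}
  add_mem' {f g} hf hg := by
    have h : ext (f + g) = fun x => ext f x + ext g x := by
      funext x
      by_cases hx : IsUnit x <;> simp [ext, hx]
    change ContDiffOn ℝ ∞ (ext (f + g)) (glSet n)
    rw [h]
    exact ContDiffOn.add hf hg
  zero_mem' := by
    have h : ext (0 : GL n ℂ → ℂ) = fun _ => 0 := by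
      funext x
      by_cases hx : IsUnit x <;> simp [ext, hx]
    change ContDiffOn ℝ ∞ (ext (0 : GL n ℂ → ℂ)) (glSet n)
    rw [h]
    exact contDiffOn_const
  smul_mem' c f hf := by
    have h : ext (c • f) = fun x => c * ext f x := by
      funext x
      by_cases hx : IsUnit x <;> simp [ext, hx]
    change ContDiffOn ℝ ∞ (ext (c • f)) (glSet n)
    rw [h]
    exact contDiffOn_const.mul hf

variable (n) in
/-- The space `C^∞(GL_n(ℂ))` of smooth complex-valued functions. A new name for
`smoothSubmodule n`, so that it does not carry the topology of pointwise convergence. -/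
def SmoothFun : Type := smoothSubmodule n

instance : AddCommGroup (SmoothFun n) := inferInstanceAs (AddCommGroup (smoothSubmodule n))

instance : Module ℂ (SmoothFun n) := inferInstanceAs (Module ℂ (smoothSubmodule n))

instance : CoeFun (SmoothFun n) (fun _ => GL n ℂ → ℂ) := ⟨fun f => f.1⟩

/-- The usual Fréchet topology of `C^∞(GL_n(ℂ))`: uniform convergence of the derivatives of every
order on all compact subsets. -/
instance : TopologicalSpace (SmoothFun n) :=
  ⨅ m : ℕ, TopologicalSpace.induced
    (fun f : SmoothFun n =>
      UniformOnFun.ofFun {K : Set (Matrix n n ℂ) | IsCompact K ∧ K ⊆ glSet n}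
        (iteratedFDeriv ℝ m (ext f)))
    inferInstance

variable (n) in
/-- The right translations `(R_g f)(x) = f (x g)` on `C^∞(GL_n(ℂ))`. -/
def rightTranslation : Representation ℂ (GL n ℂ) (SmoothFun n) where
  toFun g :=
    { toFun := fun f => ⟨fun x => f (x * g), IsSmooth.translate f.2 g⟩
      map_add' := fun _ _ => rfl
      map_smul' := fun _ _ => rfl }
  map_one' := by
    refine LinearMap.ext fun f => Subtype.ext (funext fun x => ?_)
    exact congrArg f (mul_one x)
  map_mul' g h := by
    refine LinearMap.ext fun f => Subtype.ext (funext fun x => ?_)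
    exact congrArg f (mul_assoc x g h).symm

end SmoothFunctions

section Induced

variable {p q : ℕ}

/-- The element with blocks `a, b, 0, d` of the parabolic subgroup `P_{p,q}` of `GL_{p+q}(ℂ)`.
The elements of `P_{p,q}` are exactly these. -/
def parabolicElt (a : GL (Fin p) ℂ) (b : Matrix (Fin p) (Fin q) ℂ) (d : GL (Fin q) ℂ) :
    GL (Fin p ⊕ Fin q) ℂ where
  val := Matrix.fromBlocks a.val b 0 d.val
  inv := Matrix.fromBlocks a⁻¹.val (-(a⁻¹.val * b * d⁻¹.val)) 0 d⁻¹.val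
  val_inv := by
    rw [Matrix.fromBlocks_multiply, ← Matrix.fromBlocks_one]
    simp [← Matrix.mul_assoc, -Matrix.coe_units_inv]
  inv_val := by
    rw [Matrix.fromBlocks_multiply, ← Matrix.fromBlocks_one]
    simp [Matrix.mul_assoc, -Matrix.coe_units_inv]

/-- The factor by which multiplication by `z` scales the additive Haar measure of `ℂ`. -/
def nu (z : ℂˣ) : ℝ := ‖(z : ℂ)‖ ^ 2

/-- The modular function `ν^q ⊗ ν^{-p}` of `P_{p,q}`, as a function of the diagonal blocks. -/
def modular (a : GL (Fin p) ℂ) (d : GL (Fin q) ℂ) : ℝ :=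
  nu (Matrix.GeneralLinearGroup.det a) ^ q * (nu (Matrix.GeneralLinearGroup.det d) ^ p)⁻¹

/-- The space of `χ₁ × χ₂` (normalized parabolic induction): smooth functions `f` on
`GL_{p+q}(ℂ)` with `f (y x) = χ₁(a) χ₂(d) Δ(y)^{1/2} f (x)` for all `y ∈ P_{p,q}` with diagonal
blocks `a, d`. It has the topology induced by `C^∞`. -/
def inducedSpace (χ₁ : GL (Fin p) ℂ →* ℂˣ) (χ₂ : GL (Fin q) ℂ →* ℂˣ) :
    Submodule ℂ (SmoothFun (Fin p ⊕ Fin q)) where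
  carrier := {f | ∀ (a : GL (Fin p) ℂ) (b : Matrix (Fin p) (Fin q) ℂ) (d : GL (Fin q) ℂ)
    (x : GL (Fin p ⊕ Fin q) ℂ), f (parabolicElt a b d * x) =
      (χ₁ a : ℂ) * (χ₂ d : ℂ) * (√(modular a d) : ℝ) * f x}
  add_mem' {f g} hf hg a b d x := by
    change f _ + g _ = _ * (f x + g x)
    rw [hf a b d x, hg a b d x, mul_add]
  zero_mem' _ _ _ _ := (mul_zero _).symm
  smul_mem' c f hf a b d x := by
    change c * f _ = _ * (c * f x)
    rw [hf a b d x, mul_left_comm]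

/-- The representation `χ₁ × χ₂` of `GL_{p+q}(ℂ)`, by right translations. -/
def induced (χ₁ : GL (Fin p) ℂ →* ℂˣ) (χ₂ : GL (Fin q) ℂ →* ℂˣ) :
    Representation ℂ (GL (Fin p ⊕ Fin q) ℂ) (inducedSpace χ₁ χ₂) where
  toFun g := (rightTranslation (Fin p ⊕ Fin q) g).restrict fun f hf a b d x => by
    change f (parabolicElt a b d * x * g) = _ * f (x * g)
    rw [mul_assoc, hf a b d (x * g)]
  map_one' := by
    refine LinearMap.ext fun f => Subtype.ext ?_
    exact LinearMap.congr_fun (map_one (rightTranslation (Fin p ⊕ Fin q))) f.1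
  map_mul' g h := by
    refine LinearMap.ext fun f => Subtype.ext ?_
    exact LinearMap.congr_fun (map_mul (rightTranslation (Fin p ⊕ Fin q)) g h) f.1

/-- The character `δ = det` of `GL_k(ℂ)`. -/
def detChar (k : ℕ) : GL (Fin k) ℂ →* ℂˣ := Matrix.GeneralLinearGroup.det

/-- The character `δ̄`, the complex conjugate of `det`, of `GL_k(ℂ)`. -/
def detBarChar (k : ℕ) : GL (Fin k) ℂ →* ℂˣ :=
  (Units.map (starRingEnd ℂ).toMonoidHom).comp Matrix.GeneralLinearGroup.det

end Induced

section DifferentialOperators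

variable {k : ℕ}

/-- The element `exp Z`, with blocks `1, 0, z, 1`, of the opposite unipotent radical, where `Z` is
the element of its (abelian) Lie algebra with lower left block `z` and zeros elsewhere. -/
def lowerElt (z : Matrix (Fin k) (Fin k) ℂ) : GL (Fin k ⊕ Fin k) ℂ where
  val := Matrix.fromBlocks 1 0 z 1
  inv := Matrix.fromBlocks 1 0 (-z) 1
  val_inv := by simp [Matrix.fromBlocks_multiply]
  inv_val := by simp [Matrix.fromBlocks_multiply]

/-- The vector field `L_Z` of the left action, `(L_Z f)(x) = d/dt f (exp(-tZ) x)` at `t = 0`,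
for `Z` in the opposite nilradical with lower left block `z`. -/
def leftDeriv (z : Matrix (Fin k) (Fin k) ℂ) (f : GL (Fin k ⊕ Fin k) ℂ → ℂ)
    (x : GL (Fin k ⊕ Fin k) ℂ) : ℂ :=
  deriv (fun t : ℝ => f (lowerElt (-(t • z)) * x)) 0

/-- `L_u` for the element `u = (E - √-1 (√-1 E)) / 2` of the complexified opposite nilradical, where
`E` is the matrix unit in position `(r, s)` of the lower left block: up to sign, the Wirtinger
derivative `∂/∂z_{rs}`. As a function on the nilradical, `u` is a holomorphic coordinate: the entry in
position `(s, r)`, the pairing of `Z` and `Y` being `2 Re tr(ZY)`. -/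
def leftWirtinger (r s : Fin k) (f : GL (Fin k ⊕ Fin k) ℂ → ℂ)
    (x : GL (Fin k ⊕ Fin k) ℂ) : ℂ :=
  (leftDeriv (Matrix.single r s 1) f x
    - Complex.I * leftDeriv (Matrix.single r s Complex.I) f x) / 2

/-- The conjugate Wirtinger derivative; the corresponding function on the nilradical is the complex
conjugate of the entry in position `(s, r)`. -/
def leftWirtingerBar (r s : Fin k) (f : GL (Fin k ⊕ Fin k) ℂ → ℂ)
    (x : GL (Fin k ⊕ Fin k) ℂ) : ℂ :=
  (leftDeriv (Matrix.single r s 1) f x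
    + Complex.I * leftDeriv (Matrix.single r s Complex.I) f x) / 2

/-- The determinant, by the Leibniz formula, of a matrix of operators on functions. It is
applied to operators that commute on smooth functions. -/
def detOp {S : Type} (D : Fin k → Fin k → (S → ℂ) → (S → ℂ)) (f : S → ℂ) (x : S) : ℂ :=
  ∑ σ : Equiv.Perm (Fin k), ((Equiv.Perm.sign σ : ℤ) : ℂ) *
    ((List.finRange k).foldr (fun s h => D (σ s) s h) f) x

/-- The operator `L_u` for `u = det` on the nilradical: the determinant of the matrix of the
operators `leftWirtinger r s`. Its `i`-th iterate is `L_u` for `u = det ^ i`. -/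
def leftDet : (GL (Fin k ⊕ Fin k) ℂ → ℂ) → (GL (Fin k ⊕ Fin k) ℂ → ℂ) := detOp leftWirtinger

/-- The operator `L_u` for `u` the complex conjugate of `det` on the nilradical. -/
def leftDetBar : (GL (Fin k ⊕ Fin k) ℂ → ℂ) → (GL (Fin k ⊕ Fin k) ℂ → ℂ) :=
  detOp leftWirtingerBar

end DifferentialOperators

end LineBundleGr

end

/-!
Write `∂` for the matrix of commuting operators `∂_{rs}` of the opposite nilradical. The two
operators of the theorem are treated together: `σ` is an `ℝ`-algebra endomorphism of `ℂ`, that is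
the identity or the conjugation, `wirtinger σ X` is the `σ`-linear part of the vector field `L_X`,
and `δ` stands for `σ ∘ det`.

Right translations commute with the operators `L_X`, and `L_X` is continuous because it is a first
order differential operator with smooth coefficients. What has to be shown is that `det(∂)^i`
sends functions transforming under the parabolic subgroup by the source character to functions
transforming by the target character, and that it does not vanish on the source.

For the Levi subgroup, conjugation by `diag(a, d)` substitutes `σ(d)⁻¹ ∂ σ(a)`, up to transposition,
for the matrix `∂`, so that `det(∂)^i` picks up `(δ(a) / δ(d))^i` (`translateLeft_lowerAlg`).
For the unipotent radical, the statement is that `det^i` gives a singular vector of a scalar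
generalized Verma module. The operators `wirtinger σ E`, for matrix units `E`, satisfy the
commutation relations of `𝔤𝔩_{2k}`, and moving an upper triangular one through `P(∂)` applied to a
vector of the given weight leaves `Q(∂)` applied to that vector, with
`Q = (k - α - β) ∂P/∂X_{ba} - ∑ t, ∂/∂X_{bt} (column operation a ← t on P)`
(`upper_aeval_apply`). Column operations multiply `det^i` by `i` or kill it, so that `Q = 0` for
`P = det^i` when `α + β = k - i`, which is the relation between the weights of the source
(`upper_aeval_genericDet_pow`). The `σ̄`-linear parts of the upper triangular fields commute with
`P(∂)` and kill `f`, so the function `det(∂)^i f` is annihilated by the real vector fields of the upper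
unipotent group, hence invariant under that group (`leftField_upper_lowerAlg`,
`apply_upper_mul_of_leftField_eq_zero`).

For the nonvanishing, with `C` and `D` the lower blocks of `x` and `Y = (C, D)`, the function
`δ(C)^i * δ̄(D)^j * |det x|^k * det(Y Yᴴ)^{-k}` for `j ≥ 0`, and a similar one for `j < 0`, lies in
the source (`sourceWitness`). At `x = 1` all entries of `C` vanish, so that
`det(∂)^i` must spend all its derivatives on `δ(C)^i`; this gives, up to sign,
`∑ α, c_α² α!`, where the `c_α` are the integer coefficients of `det^i` (`eval_self_ne_zero`).
-/

noncomputable section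

namespace LineBundleGr

/-! ### Polynomials in commuting lowering operators -/

section Algebra

open MvPolynomial

theorem derivation_prod {R A ι : Type*} [CommRing R] [CommRing A] [Algebra R A] [DecidableEq ι]
    (D : Derivation R A A) (f : ι → A) (s : Finset ι) :
    D (∏ i ∈ s, f i) = ∑ i ∈ s, (∏ j ∈ s.erase i, f j) * D (f i) := by
  induction s using Finset.induction_on with
  | empty => simp
  | insert a s ha ih =>
    rw [Finset.prod_insert ha, Derivation.leibniz, ih, Finset.sum_insert ha,
      Finset.erase_insert ha, add_comm, smul_eq_mul, smul_eq_mul, Finset.mul_sum]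
    congr 1
    refine Finset.sum_congr rfl fun i hi => ?_
    have hne : a ≠ i := fun h => ha (h ▸ hi)
    rw [Finset.erase_insert_of_ne hne, Finset.prod_insert (fun h => ha (Finset.mem_of_mem_erase h)),
      mul_assoc]

/-- A derivation that moves column `s` into column `a` and kills the other columns acts on the
determinant as the sum over columns of the determinants with one column differentiated; only
column `a` contributes, and that determinant has two equal columns unless `a = s`. -/
theorem derivation_det_of_col {R A : Type*} [CommRing R] [CommRing A] [Algebra R A] {k : ℕ}
    (D : Derivation R A A) (M : Matrix (Fin k) (Fin k) A) (a s : Fin k)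
    (h : ∀ r q, D (M r q) = if q = a then M r s else 0) :
    D M.det = if a = s then M.det else 0 := by
  have h1 : D M.det = (M.updateCol a fun r => M r s).det := by
    rw [Matrix.det_apply, Matrix.det_apply, map_sum]
    refine Finset.sum_congr rfl fun σ _ => ?_
    rw [Units.smul_def, Units.smul_def, map_zsmul, derivation_prod]
    congr 1
    rw [Finset.sum_eq_single a, ← Finset.prod_erase_mul _ _ (Finset.mem_univ a)]
    · congr 1
      · exact Finset.prod_congr rfl fun j hj => by
          rw [Matrix.updateCol_ne (Finset.ne_of_mem_erase hj)]
      · rw [h, if_pos rfl, Matrix.updateCol_self]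
    · intro b _ hb
      rw [h, if_neg hb, mul_zero]
    · simp
  rw [h1]
  split_ifs with has
  · subst has
    congr 1
    exact Matrix.updateCol_eq_self M a
  · refine Matrix.det_zero_of_column_eq has fun r => ?_
    rw [Matrix.updateCol_self, Matrix.updateCol_ne (Ne.symm has)]

theorem derivation_det_pow_of_col {R A : Type*} [CommRing R] [CommRing A] [Algebra R A] {k : ℕ}
    (D : Derivation R A A) (M : Matrix (Fin k) (Fin k) A) (a s : Fin k)
    (h : ∀ r q, D (M r q) = if q = a then M r s else 0) (i : ℕ) :
    D (M.det ^ i) = if a = s then (i : A) * M.det ^ i else 0 := by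
  rw [Derivation.leibniz_pow, derivation_det_of_col D M a s h]
  split_ifs with has
  · rcases i with _ | i
    · simp
    · simp only [Nat.add_sub_cancel, smul_eq_mul, nsmul_eq_mul, pow_succ]
      
  · simp

open scoped IsMulCommutative in
/-- Polynomials can be evaluated at a family of pairwise commuting elements of a noncommutative
algebra. -/
theorem exists_aeval_of_commute {ι B : Type*} [Ring B] [Algebra ℂ B] (f : ι → B)
    (hf : ∀ a b, f a * f b = f b * f a) :
    ∃ ev : MvPolynomial ι ℂ →ₐ[ℂ] B, ∀ a, ev (X a) = f a := by
  have := Algebra.isMulCommutative_adjoin ℂ (s := Set.range f) (by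
    rintro _ ⟨a, rfl⟩ _ ⟨b, rfl⟩
    exact hf a b)
  refine ⟨(Algebra.adjoin ℂ (Set.range f)).val.comp
    (aeval fun a => (⟨f a, Algebra.subset_adjoin ⟨a, rfl⟩⟩ : Algebra.adjoin ℂ (Set.range f))),
    fun a => ?_⟩
  rw [AlgHom.comp_apply, aeval_X]
  rfl

/-- An operator whose commutators with the generators of a commutative algebra of operators stay
in that algebra acts on it as a derivation. -/
theorem commutator_aeval {ι B : Type*} [Ring B] [Algebra ℂ B]
    (ev : MvPolynomial ι ℂ →ₐ[ℂ] B) (H : B)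
    (D : Derivation ℂ (MvPolynomial ι ℂ) (MvPolynomial ι ℂ))
    (h : ∀ a, H * ev (X a) = ev (X a) * H + ev (D (X a))) (P : MvPolynomial ι ℂ) :
    H * ev P = ev P * H + ev (D P) := by
  induction P using MvPolynomial.induction_on with
  | C c =>
    rw [← algebraMap_eq, AlgHom.commutes, Derivation.map_algebraMap, map_zero, add_zero,
      Algebra.commutes]
  | add p q hp hq => rw [map_add, mul_add, hp, hq, map_add, map_add]; noncomm_ring
  | mul_X p a hp =>
    rw [map_mul, ← mul_assoc, hp, add_mul, mul_assoc, h, Derivation.leibniz, map_add, smul_eq_mul,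
      smul_eq_mul, mul_comm (X a), map_mul, map_mul, mul_add, mul_assoc, ← add_assoc]

variable {k : ℕ}

/-- The vector field `∑ p, X (p, s) ∂/∂X (p, a)` on the space of matrices: it replaces column `a`
by column `s`. -/
def colField (a s : Fin k) :
    Derivation ℂ (MvPolynomial (Fin k × Fin k) ℂ) (MvPolynomial (Fin k × Fin k) ℂ) :=
  ∑ p, (X (p, s) : MvPolynomial (Fin k × Fin k) ℂ) • pderiv (p, a)

/-- The vector field `∑ q, X (r, q) ∂/∂X (b, q)` on the space of matrices: it replaces row `b`
by row `r`. -/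
def rowField (r b : Fin k) :
    Derivation ℂ (MvPolynomial (Fin k × Fin k) ℂ) (MvPolynomial (Fin k × Fin k) ℂ) :=
  ∑ q, (X (r, q) : MvPolynomial (Fin k × Fin k) ℂ) • pderiv (b, q)

theorem derivation_sum_apply {R A ι : Type*} [CommRing R] [CommRing A] [Algebra R A]
    (s : Finset ι) (D : ι → Derivation R A A) (x : A) :
    (∑ i ∈ s, D i) x = ∑ i ∈ s, D i x := by
  rw [← Derivation.coeFnAddMonoidHom_apply, map_sum, Finset.sum_apply]
  rfl

theorem colField_apply (a s : Fin k) (P : MvPolynomial (Fin k × Fin k) ℂ) :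
    colField a s P = ∑ p, X (p, s) * pderiv (p, a) P := by
  simp [colField, derivation_sum_apply]

theorem rowField_apply (r b : Fin k) (P : MvPolynomial (Fin k × Fin k) ℂ) :
    rowField r b P = ∑ q, X (r, q) * pderiv (b, q) P := by
  simp [rowField, derivation_sum_apply]

theorem colField_X (a s p q : Fin k) :
    colField a s (X (p, q)) = if q = a then X (p, s) else 0 := by
  rw [colField_apply]
  by_cases h : q = a
  · subst h
    simp [pderiv_X, Pi.single_apply]
  · simp [pderiv_X, h]

theorem rowField_X (r b p q : Fin k) :
    rowField r b (X (p, q)) = if p = b then X (r, q) else 0 := by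
  rw [rowField_apply]
  by_cases h : p = b
  · subst h
    simp [pderiv_X, Pi.single_apply]
  · simp [pderiv_X, h]

/-- The determinant of the generic matrix. -/
def genericDet (k : ℕ) : MvPolynomial (Fin k × Fin k) ℂ :=
  (Matrix.mvPolynomialX (Fin k) (Fin k) ℂ).det

theorem colField_genericDet_pow (a s : Fin k) (i : ℕ) :
    colField a s (genericDet k ^ i) =
      if a = s then (i : MvPolynomial _ ℂ) * genericDet k ^ i else 0 :=
  derivation_det_pow_of_col _ _ a s (fun r q => by
    simp only [Matrix.mvPolynomialX_apply, colField_X]) i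

/-- The operators `w I J` satisfy the commutation relations of the matrix units of
`𝔤𝔩_{2k}`. -/
def IsMatrixUnitRep {B : Type*} [Ring B] (w : Fin k ⊕ Fin k → Fin k ⊕ Fin k → B) : Prop :=
  ∀ I J K L, w I J * w K L - w K L * w I J =
    (if J = K then w I L else 0) - (if L = I then w K J else 0)

theorem IsMatrixUnitRep.mul_comm_of_ne {B : Type*} [Ring B]
    {w : Fin k ⊕ Fin k → Fin k ⊕ Fin k → B} (hw : IsMatrixUnitRep w) {I J K L : Fin k ⊕ Fin k}
    (h : J ≠ K) (h' : L ≠ I) : w I J * w K L = w K L * w I J := by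
  have := hw I J K L
  rwa [if_neg h, if_neg h', sub_zero, sub_eq_zero] at this

variable {V : Type*} [AddCommGroup V] [Module ℂ V]
  {w : Fin k ⊕ Fin k → Fin k ⊕ Fin k → Module.End ℂ V}
  {ev : MvPolynomial (Fin k × Fin k) ℂ →ₐ[ℂ] Module.End ℂ V}

open Sum in
/-- The action of the upper right matrix units on a scalar generalized Verma module: if `v` is
killed by these and is an eigenvector of weights `-α`, `β` under the diagonal blocks, they act on
the vectors `P(∂) v` by a second order differential operator in `P`. -/
theorem upper_aeval_apply (hw : IsMatrixUnitRep w) (hev : ∀ r s, ev (X (r, s)) = w (inr r) (inl s))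
    (v : V) (α β : ℂ)
    (hu : ∀ a b, w (inl a) (inr b) v = 0)
    (ha : ∀ a b, w (inl a) (inl b) v = if a = b then -α • v else 0)
    (hd : ∀ a b, w (inr a) (inr b) v = if a = b then β • v else 0)
    (a b : Fin k) (P : MvPolynomial (Fin k × Fin k) ℂ) :
    w (inl a) (inr b) (ev P v) =
      ev ((k - α - β) • pderiv (b, a) P - ∑ t, pderiv (b, t) (colField a t P)) v := by
  -- The diagonal blocks act on `P(∂) v` by column and row operations on `P`, shifted by the weight.
  have hA : ∀ (a s : Fin k) (P : MvPolynomial (Fin k × Fin k) ℂ),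
      w (inl a) (inl s) (ev P v) = (if a = s then -α • ev P v else 0) - ev (colField a s P) v := by
    intro a s P
    have h := commutator_aeval ev (w (inl a) (inl s)) (-colField a s) (by
      rintro ⟨p, q⟩
      rw [Derivation.neg_apply, colField_X, hev, ← sub_eq_iff_eq_add', hw]
      by_cases h : q = a <;> simp [h, hev]) P
    have h' := LinearMap.congr_fun h v
    rw [Module.End.mul_apply, LinearMap.add_apply, Module.End.mul_apply, ha] at h'
    rw [h', Derivation.neg_apply, map_neg, LinearMap.neg_apply, ← sub_eq_add_neg]
    split_ifs <;> simp
  have hD : ∀ (r b : Fin k) (P : MvPolynomial (Fin k × Fin k) ℂ),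
      w (inr r) (inr b) (ev P v) = (if r = b then β • ev P v else 0) + ev (rowField r b P) v := by
    intro r b P
    have h := commutator_aeval ev (w (inr r) (inr b)) (rowField r b) (by
      rintro ⟨p, q⟩
      rw [rowField_X, hev, ← sub_eq_iff_eq_add', hw]
      by_cases h : p = b
      · simp [h, hev]
      · simp [h, Ne.symm h]) P
    have h' := LinearMap.congr_fun h v
    rw [Module.End.mul_apply, LinearMap.add_apply, Module.End.mul_apply, hd] at h'
    rw [h']
    split_ifs <;> simp
  induction P using MvPolynomial.induction_on with
  | C c =>
    rw [← algebraMap_eq, AlgHom.commutes]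
    simp [Module.algebraMap_end_apply, hu]
  | add p q hp hq =>
    rw [map_add, LinearMap.add_apply, map_add, hp, hq, ← LinearMap.add_apply, ← map_add]
    congr 2
    simp only [map_add, smul_add, Finset.sum_add_distrib]
    abel
  | mul_X P x hP =>
    obtain ⟨r, s⟩ := x
    have h := LinearMap.congr_fun (hw (inl a) (inr b) (inr r) (inl s)) (ev P v)
    simp only [LinearMap.sub_apply, Module.End.mul_apply, inr.injEq, inl.injEq] at h
    rw [sub_eq_iff_eq_add'] at h
    rw [mul_comm P, map_mul, Module.End.mul_apply, hev, h, hP]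
    have hpoly : (k - α - β) • pderiv (b, a) (X (r, s) * P) -
          ∑ t, pderiv (b, t) (colField a t (X (r, s) * P)) =
        X (r, s) * ((k - α - β) • pderiv (b, a) P - ∑ t, pderiv (b, t) (colField a t P)) +
        ((if b = r then (if a = s then -α • P else 0) - colField a s P else 0) -
        (if s = a then (if r = b then β • P else 0) + rowField r b P else 0)) := by
      have h1 : ∀ t, pderiv (b, t) (colField a t (X (r, s) * P)) =
          X (r, s) * pderiv (b, t) (colField a t P) +
          (if b = r then (if s = t then colField a t P else 0) else 0) +
          (if s = a then X (r, t) * pderiv (b, t) P + (if r = b then P else 0) else 0) := by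
        intro t
        have h2 : pderiv (b, t) (if s = a then X (r, t) else 0 : MvPolynomial (Fin k × Fin k) ℂ) =
            if s = a then (if r = b then 1 else 0) else 0 := by
          split_ifs with h1 h2
          · rw [h2, pderiv_X_self]
          · rw [pderiv_X_of_ne (by simp [h2])]
          · rw [map_zero]
        have h3 : pderiv (b, t) (X (r, s) : MvPolynomial (Fin k × Fin k) ℂ) =
            if b = r then (if s = t then 1 else 0) else 0 := by
          rw [pderiv_X, Pi.single_apply]
          split_ifs <;> simp_all
        rw [Derivation.leibniz, colField_X, map_add, smul_eq_mul, smul_eq_mul, Derivation.leibniz,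
          Derivation.leibniz, h2, h3]
        simp only [smul_eq_mul]
        split_ifs <;> ring
      have h4 : pderiv (b, a) (X (r, s) : MvPolynomial (Fin k × Fin k) ℂ) =
          if b = r then (if a = s then 1 else 0) else 0 := by
        rw [pderiv_X, Pi.single_apply]
        split_ifs <;> simp_all
      have h5 : ∑ t, (if b = r then (if s = t then colField a t P else 0) else 0) =
          if b = r then colField a s P else 0 := by
        split_ifs <;> simp
      have h6 : ∑ t, (if s = a then X (r, t) * pderiv (b, t) P + (if r = b then P else 0) else 0) =
          if s = a then rowField r b P + (if r = b then (k : MvPolynomial _ ℂ) * P else 0) else 0 := by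
        rw [rowField_apply]
        split_ifs <;> simp [Finset.sum_add_distrib]
      simp only [h1, Finset.sum_add_distrib, h5, h6]
      rw [Derivation.leibniz, h4, mul_sub, Finset.mul_sum]
      simp only [smul_eq_C_mul, map_sub, map_neg, map_natCast, smul_eq_mul, eq_comm (a := r),
        eq_comm (a := s)]
      split_ifs <;> ring
    rw [hpoly]
    generalize (k - α - β) • pderiv (b, a) P - ∑ t, pderiv (b, t) (colField a t P) = Q
    rw [map_add, map_sub, map_mul, hev]
    simp only [LinearMap.add_apply, LinearMap.sub_apply, Module.End.mul_apply]
    congr 1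
    congr 1
    · split_ifs <;> simp_all only [map_sub, map_smul, map_zero, LinearMap.sub_apply,
        LinearMap.smul_apply, LinearMap.zero_apply, if_true, if_false]
    · split_ifs <;> simp_all only [map_add, map_smul, map_zero, LinearMap.add_apply,
        LinearMap.smul_apply, LinearMap.zero_apply, if_true, if_false]

open Sum in
/-- `det(∂)^i v` is a singular vector for weights with `α + β = k - i`. -/
theorem upper_aeval_genericDet_pow (hw : IsMatrixUnitRep w)
    (hev : ∀ r s, ev (X (r, s)) = w (inr r) (inl s))
    (v : V) (α β : ℂ) (i : ℕ) (hi : α + β = k - i)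
    (hu : ∀ a b, w (inl a) (inr b) v = 0)
    (ha : ∀ a b, w (inl a) (inl b) v = if a = b then -α • v else 0)
    (hd : ∀ a b, w (inr a) (inr b) v = if a = b then β • v else 0)
    (a b : Fin k) :
    w (inl a) (inr b) (ev (genericDet k ^ i) v) = 0 := by
  rw [upper_aeval_apply hw hev v α β hu ha hd]
  have h0 : (k - α - β) • pderiv (b, a) (genericDet k ^ i) -
      ∑ t, pderiv (b, t) (colField a t (genericDet k ^ i)) = 0 := by
    have hk : (k : ℂ) - α - β = i := by linear_combination -hi
    rw [Finset.sum_eq_single a]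
    · rw [colField_genericDet_pow, if_pos rfl, hk, Derivation.leibniz]
      simp [smul_eq_C_mul]
    · intro t _ ht
      rw [colField_genericDet_pow, if_neg (Ne.symm ht), map_zero]
    · simp
  rw [h0, map_zero, LinearMap.zero_apply]

end Algebra

/-! ### Vector fields of the left action -/

section LeftFields

attribute [local instance] Matrix.normedAddCommGroup Matrix.normedSpace

variable {n : Type} [Fintype n] [DecidableEq n]

theorem isOpen_glSet : IsOpen (glSet n) := by
  have h : glSet n = {x | Matrix.det x ≠ 0} := by
    ext x
    exact (Matrix.isUnit_iff_isUnit_det x).trans isUnit_iff_ne_zero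
  rw [h]
  exact isOpen_ne_fun (Continuous.matrix_det continuous_id) continuous_const

theorem mem_glSet (g : GL n ℂ) : (g : Matrix n n ℂ) ∈ glSet n := g.isUnit

theorem isSmooth_of_eq {f : GL n ℂ → ℂ} (F : Matrix n n ℂ → ℂ) (hF : ContDiffOn ℝ ∞ F (glSet n))
    (h : ∀ g : GL n ℂ, f g = F g) : IsSmooth f := by
  refine ContDiffOn.congr hF ?_
  rintro _ ⟨u, rfl⟩
  rw [ext_val, h]

variable (n) in
/-- The algebra of smooth functions on `GL_n(ℂ)`. -/
def smoothAlg : Subalgebra ℂ (GL n ℂ → ℂ) where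
  carrier := {f | IsSmooth f}
  mul_mem' {f g} hf hg := isSmooth_of_eq (fun x => ext f x * ext g x) (hf.mul hg) fun x => by
    simp [ext_val]
  add_mem' := (smoothSubmodule n).add_mem
  algebraMap_mem' c := isSmooth_of_eq (fun _ => c) contDiffOn_const fun _ => rfl

theorem contDiffAt_ext (f : smoothAlg n) (g : GL n ℂ) : ContDiffAt ℝ ∞ (ext f.1) g.1 :=
  ContDiffOn.contDiffAt f.2 (isOpen_glSet.mem_nhds (mem_glSet g))

theorem differentiableAt_ext (f : smoothAlg n) (g : GL n ℂ) :
    DifferentiableAt ℝ (ext f.1) g.1 :=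
  (contDiffAt_ext f g).differentiableAt (by simp)

/-- Left multiplication by a matrix, as a continuous real-linear map. -/
def mulLeftCLM (X : Matrix n n ℂ) : Matrix n n ℂ →L[ℝ] Matrix n n ℂ :=
  LinearMap.toContinuousLinearMap (LinearMap.mulLeft ℝ X)

@[simp] theorem mulLeftCLM_apply (X x : Matrix n n ℂ) : mulLeftCLM X x = X * x := rfl

theorem isSmooth_leftField (X : Matrix n n ℂ) (f : smoothAlg n) :
    IsSmooth fun g : GL n ℂ => -fderiv ℝ (ext f.1) g.1 (X * g.1) :=
  isSmooth_of_eq (fun x => -fderiv ℝ (ext f.1) x (mulLeftCLM X x))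
    (((ContDiffOn.fderiv_of_isOpen (m := ∞) f.2 isOpen_glSet (by simp)).clm_apply
      (mulLeftCLM X).contDiff.contDiffOn).neg) fun _ => rfl

/-- The vector field on `GL_n(ℂ)` of the left action: `(L_X f)(x) = d/dt f (exp(-tX) x)` at
`t = 0`. It is written as the derivative of `f` at `x` in the direction `-X x`. -/
def leftField (X : Matrix n n ℂ) : Derivation ℂ (smoothAlg n) (smoothAlg n) :=
  Derivation.mk'
    { toFun := fun f => ⟨fun g => -fderiv ℝ (ext f.1) g.1 (X * g.1), isSmooth_leftField X f⟩
      map_add' := fun f g => by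
        refine Subtype.ext (funext fun x => ?_)
        have h : ext (f + g : smoothAlg n).1 = ext f.1 + ext g.1 := by
          funext x
          by_cases hx : IsUnit x <;> simp [ext, hx]
        refine (congrArg (fun F => -fderiv ℝ F x.1 (X * x.1)) h).trans ?_
        refine (congrArg (fun ℓ => -ℓ (X * x.1))
          (fderiv_add (differentiableAt_ext f x) (differentiableAt_ext g x))).trans ?_
        exact neg_add _ _
      map_smul' := fun c f => by
        refine Subtype.ext (funext fun x => ?_)
        have h : ext (c • f : smoothAlg n).1 = c • ext f.1 := by
          funext x
          by_cases hx : IsUnit x <;> simp [ext, hx]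
        refine (congrArg (fun F => -fderiv ℝ F x.1 (X * x.1)) h).trans ?_
        refine (congrArg (fun ℓ => -ℓ (X * x.1))
          (fderiv_const_smul (differentiableAt_ext f x) c)).trans ?_
        exact (mul_neg c _).symm }
    (fun f g => by
      refine Subtype.ext (funext fun x => ?_)
      have h : ext (f * g : smoothAlg n).1 = ext f.1 * ext g.1 := by
        funext x
        by_cases hx : IsUnit x <;> simp [ext, hx]
      change -fderiv ℝ (ext (f * g : smoothAlg n).1) x.1 (X * x.1) =
        f.1 x * -fderiv ℝ (ext g.1) x.1 (X * x.1) + g.1 x * -fderiv ℝ (ext f.1) x.1 (X * x.1)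
      rw [h]
      refine (congrArg (fun ℓ => -ℓ (X * x.1))
        (fderiv_mul (differentiableAt_ext f x) (differentiableAt_ext g x))).trans ?_
      change -(ext f.1 x.1 * fderiv ℝ (ext g.1) x.1 (X * x.1) +
        ext g.1 x.1 * fderiv ℝ (ext f.1) x.1 (X * x.1)) = _
      rw [ext_val, ext_val]
      ring)

theorem leftField_apply (X : Matrix n n ℂ) (f : smoothAlg n) (g : GL n ℂ) :
    (leftField X f).1 g = -fderiv ℝ (ext f.1) g.1 (X * g.1) := rfl

theorem smoothAlg_ext {f g : smoothAlg n} (h : ∀ x, f.1 x = g.1 x) : f = g :=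
  Subtype.ext (funext h)

theorem leftField_add (X Y : Matrix n n ℂ) (f : smoothAlg n) :
    leftField (X + Y) f = leftField X f + leftField Y f := by
  refine smoothAlg_ext fun x => ?_
  change _ = (leftField X f).1 x + (leftField Y f).1 x
  simp only [leftField_apply]
  rw [add_mul, map_add, neg_add]

theorem leftField_smul (r : ℝ) (X : Matrix n n ℂ) (f : smoothAlg n) :
    leftField (r • X) f = (r : ℂ) • leftField X f := by
  refine smoothAlg_ext fun x => ?_
  change _ = (r : ℂ) * (leftField X f).1 x
  simp only [leftField_apply]
  rw [Matrix.smul_mul, map_smul, Complex.real_smul, mul_neg]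

theorem hasDerivAt_sub_smul {m : Type} [Fintype m] (x v : Matrix m m ℂ) (t : ℝ) :
    HasDerivAt (fun s : ℝ => x - s • v) (-v) t := by
  have := ((hasDerivAt_id t).smul_const v).const_sub x
  rw [one_smul] at this
  exact this

/-- `leftField X` can be computed along any curve with the right velocity, such as
`t ↦ (1 - tX) g` instead of `t ↦ exp(-tX) g`. -/
theorem hasDerivAt_leftField (X : Matrix n n ℂ) (f : smoothAlg n) (g : GL n ℂ)
    {γ : ℝ → Matrix n n ℂ} {t : ℝ} (h0 : γ t = g) (hγ : HasDerivAt γ (-(X * g.1)) t) :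
    HasDerivAt (fun s => ext f.1 (γ s)) ((leftField X f).1 g) t := by
  rw [leftField_apply, ← map_neg]
  have h := (differentiableAt_ext f g).hasFDerivAt
  rw [← h0] at h
  have h' := HasFDerivAt.comp_hasDerivAt t h hγ
  rw [h0] at h'
  exact h'

theorem ext_leftField_eventuallyEq (X : Matrix n n ℂ) (f : smoothAlg n) (g : GL n ℂ) :
    ext (leftField X f).1 =ᶠ[nhds g.1] fun x => -fderiv ℝ (ext f.1) x (mulLeftCLM X x) := by
  filter_upwards [isOpen_glSet.mem_nhds (mem_glSet g)]
  rintro _ ⟨u, rfl⟩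
  rw [ext_val]
  rfl

theorem fderiv_neg_fderiv_clm_apply {E : Type*} [NormedAddCommGroup E] [NormedSpace ℝ E]
    {F : E → ℂ} {x : E} (hF : ContDiffAt ℝ ∞ F x) (A : E →L[ℝ] E) (v : E) :
    -fderiv ℝ (fun y => -fderiv ℝ F y (A y)) x v =
      fderiv ℝ (fderiv ℝ F) x v (A x) + fderiv ℝ F x (A v) := by
  have h2 : DifferentiableAt ℝ (fderiv ℝ F) x :=
    (hF.fderiv_right (m := ∞) (by simp)).differentiableAt (by simp)
  rw [fderiv_fun_neg, neg_apply, neg_neg, fderiv_clm_apply h2 A.differentiableAt,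
    A.fderiv]
  simp [add_comm]

theorem leftField_leftField_apply (X Y : Matrix n n ℂ) (f : smoothAlg n) (g : GL n ℂ) :
    (leftField X (leftField Y f)).1 g =
      fderiv ℝ (fderiv ℝ (ext f.1)) g.1 (X * g.1) (Y * g.1) +
        fderiv ℝ (ext f.1) g.1 (Y * (X * g.1)) := by
  refine (congrArg (fun ℓ : Matrix n n ℂ →L[ℝ] ℂ => -ℓ (X * g.1))
    (ext_leftField_eventuallyEq Y f g).fderiv_eq).trans ?_
  exact fderiv_neg_fderiv_clm_apply (contDiffAt_ext f g) (mulLeftCLM Y) (X * g.1)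

theorem leftField_commutator (X Y : Matrix n n ℂ) (f : smoothAlg n) :
    leftField X (leftField Y f) - leftField Y (leftField X f) = leftField (X * Y - Y * X) f := by
  refine smoothAlg_ext fun x => ?_
  change (leftField X (leftField Y f)).1 x - (leftField Y (leftField X f)).1 x = _
  have hs : fderiv ℝ (fderiv ℝ (ext f.1)) x.1 (X * x.1) (Y * x.1) =
      fderiv ℝ (fderiv ℝ (ext f.1)) x.1 (Y * x.1) (X * x.1) :=
    ((contDiffAt_infty.1 (contDiffAt_ext f x) 2).isSymmSndFDerivAt (by simp)).eq
      (X * x.1) (Y * x.1)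
  rw [leftField_leftField_apply, leftField_leftField_apply, leftField_apply, sub_mul, map_sub,
    hs, Matrix.mul_assoc, Matrix.mul_assoc]
  ring

variable (n) in
theorem isSmooth_translateLeft (y : GL n ℂ) (f : smoothAlg n) :
    IsSmooth fun g : GL n ℂ => f.1 (y * g) :=
  isSmooth_of_eq (fun x => ext f.1 (mulLeftCLM y.1 x))
    (ContDiffOn.comp f.2 (mulLeftCLM y.1).contDiff.contDiffOn
      fun _ hx => y.isUnit.mul hx) fun g => by
        rw [mulLeftCLM_apply, ← Units.val_mul, ext_val]

/-- Left translation by `y`: `f` becomes `x ↦ f (y x)`. -/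
def translateLeft (y : GL n ℂ) : Module.End ℂ (smoothAlg n) where
  toFun f := ⟨fun g => f.1 (y * g), isSmooth_translateLeft n y f⟩
  map_add' _ _ := rfl
  map_smul' _ _ := rfl

theorem translateLeft_apply (y : GL n ℂ) (f : smoothAlg n) (g : GL n ℂ) :
    (translateLeft y f).1 g = f.1 (y * g) := rfl

theorem translateLeft_leftField (y : GL n ℂ) (X : Matrix n n ℂ) (f : smoothAlg n) :
    translateLeft y (leftField X f) =
      leftField ((y⁻¹ : GL n ℂ).1 * X * y.1) (translateLeft y f) := by
  refine smoothAlg_ext fun g => ?_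
  have h : ext (translateLeft y f).1 =ᶠ[nhds g.1] fun x => ext f.1 (mulLeftCLM y.1 x) := by
    filter_upwards [isOpen_glSet.mem_nhds (mem_glSet g)]
    rintro _ ⟨u, rfl⟩
    rw [ext_val, mulLeftCLM_apply, ← Units.val_mul, ext_val, translateLeft_apply]
  have hd : fderiv ℝ (fun x => ext f.1 (mulLeftCLM y.1 x)) g.1 =
      (fderiv ℝ (ext f.1) (y * g : GL n ℂ).1).comp (mulLeftCLM y.1) :=
    (HasFDerivAt.comp (g := ext f.1) g.1 (differentiableAt_ext f (y * g)).hasFDerivAt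
      (mulLeftCLM y.1).hasFDerivAt).fderiv
  rw [translateLeft_apply, leftField_apply, leftField_apply]
  refine Eq.trans ?_
    (congrArg (fun ℓ => -ℓ ((y⁻¹ : GL n ℂ).1 * X * y.1 * g.1)) (h.fderiv_eq.trans hd).symm)
  simp only [ContinuousLinearMap.comp_apply, mulLeftCLM_apply]
  simp only [← Matrix.mul_assoc, Units.mul_inv, one_mul, Units.val_mul]

section Wirtinger

variable (σ τ : ℂ →ₐ[ℝ] ℂ)

theorem algHom_I_mul_I : σ Complex.I * σ Complex.I = -1 := by
  rw [← map_mul, Complex.I_mul_I, map_neg, map_one]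

theorem algHom_eq (c : ℂ) : σ c = c.re + c.im * σ Complex.I := by
  conv_lhs => rw [← Complex.re_add_im c]
  rw [map_add, map_mul]
  congr 1
  · exact σ.commutes c.re
  · congr 1
    exact σ.commutes c.im

/-- The `σ`-linear part of `leftField X` in `X`, where `σ` is the identity or the conjugation of
`ℂ`. -/
def wirtinger (X : Matrix n n ℂ) : Derivation ℂ (smoothAlg n) (smoothAlg n) :=
  (1 / 2 : ℂ) • (leftField X - σ Complex.I • leftField (Complex.I • X))

theorem wirtinger_def (X : Matrix n n ℂ) (f : smoothAlg n) : wirtinger σ X f =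
    (1 / 2 : ℂ) • (leftField X f - σ Complex.I • leftField (Complex.I • X) f) := rfl

theorem wirtinger_add (X Y : Matrix n n ℂ) (f : smoothAlg n) :
    wirtinger σ (X + Y) f = wirtinger σ X f + wirtinger σ Y f := by
  simp only [wirtinger_def, smul_add, leftField_add]
  module

theorem leftField_complex_smul (c : ℂ) (X : Matrix n n ℂ) (f : smoothAlg n) :
    leftField (c • X) f =
      (c.re : ℂ) • leftField X f + (c.im : ℂ) • leftField (Complex.I • X) f := by
  rw [← leftField_smul, ← leftField_smul, ← leftField_add]
  congr 2
  ext i j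
  simp only [Matrix.smul_apply, Matrix.add_apply, smul_eq_mul, Complex.real_smul]
  conv_lhs => rw [← Complex.re_add_im c]
  ring

theorem wirtinger_smul (c : ℂ) (X : Matrix n n ℂ) (f : smoothAlg n) :
    wirtinger σ (c • X) f = σ c • wirtinger σ X f := by
  have hI := algHom_I_mul_I σ
  simp only [wirtinger_def, smul_smul Complex.I c X]
  rw [leftField_complex_smul c, leftField_complex_smul (Complex.I * c), algHom_eq σ c]
  simp only [Complex.mul_re, Complex.mul_im, Complex.I_re, Complex.I_im, zero_mul, one_mul,
    zero_sub, zero_add, Complex.ofReal_neg]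
  match_scalars
  · ring
  · linear_combination (1/2 * (c.im : ℂ)) * hI

theorem wirtinger_sum {ι : Type*} (s : Finset ι) (X : ι → Matrix n n ℂ) (f : smoothAlg n) :
    wirtinger σ (∑ i ∈ s, X i) f = ∑ i ∈ s, wirtinger σ (X i) f := by
  classical
  induction s using Finset.induction_on with
  | empty =>
    have h := wirtinger_smul σ 0 (0 : Matrix n n ℂ) f
    simpa using h
  | insert a s ha ih => rw [Finset.sum_insert ha, Finset.sum_insert ha, wirtinger_add, ih]

/-- The commutator of a `σ`-linear and a `τ`-linear part. For `σ = τ` it is the `σ`-linear part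
of the bracket, and it vanishes when `τ` is the conjugate of `σ`, as `σ I * τ I` is `-1` or `1`. -/
theorem wirtinger_commutator_aux (X Y : Matrix n n ℂ) (f : smoothAlg n) :
    wirtinger σ X (wirtinger τ Y f) - wirtinger τ Y (wirtinger σ X f) =
      (1 / 4 : ℂ) • ((1 - σ Complex.I * τ Complex.I) • leftField (X * Y - Y * X) f -
        (σ Complex.I + τ Complex.I) • leftField (Complex.I • (X * Y - Y * X)) f) := by
  have h1 := leftField_commutator X Y f
  have h2 := leftField_commutator (Complex.I • X) Y f
  have h3 := leftField_commutator X (Complex.I • Y) f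
  have h4 := leftField_commutator (Complex.I • X) (Complex.I • Y) f
  have e4 : (Complex.I • X) * (Complex.I • Y) - (Complex.I • Y) * (Complex.I • X) =
      (-1 : ℝ) • (X * Y - Y * X) := by
    simp only [Matrix.smul_mul, Matrix.mul_smul, smul_smul, Complex.I_mul_I]
    module
  rw [e4, leftField_smul] at h4
  rw [Matrix.smul_mul, Matrix.mul_smul, ← smul_sub] at h2 h3
  simp only [wirtinger_def, Derivation.map_sub, Derivation.map_smul]
  rw [sub_eq_iff_eq_add] at h1 h2 h3 h4
  rw [h1, h2, h3, h4]
  simp only [Complex.ofReal_neg, Complex.ofReal_one]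
  module

theorem wirtinger_commutator (X Y : Matrix n n ℂ) (f : smoothAlg n) :
    wirtinger σ X (wirtinger σ Y f) - wirtinger σ Y (wirtinger σ X f) =
      wirtinger σ (X * Y - Y * X) f := by
  rw [wirtinger_commutator_aux, algHom_I_mul_I, wirtinger_def]
  module

/-- The composite of `σ` with complex conjugation. -/
def conjAlgHom : ℂ →ₐ[ℝ] ℂ := Complex.conjAe.toAlgHom.comp σ

theorem conjAlgHom_apply (c : ℂ) : conjAlgHom σ c = starRingEnd ℂ (σ c) := rfl

theorem conjAlgHom_I : conjAlgHom σ Complex.I = -σ Complex.I := by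
  have h : (σ Complex.I - Complex.I) * (σ Complex.I + Complex.I) = 0 := by
    linear_combination algHom_I_mul_I σ - Complex.I_mul_I
  rw [conjAlgHom_apply]
  rcases mul_eq_zero.1 h with h | h
  · rw [sub_eq_zero.1 h, Complex.conj_I]
  · rw [eq_neg_of_add_eq_zero_left h, map_neg, Complex.conj_I]

theorem wirtinger_conj_commute (X Y : Matrix n n ℂ) (f : smoothAlg n) :
    wirtinger (conjAlgHom σ) X (wirtinger σ Y f) =
      wirtinger σ Y (wirtinger (conjAlgHom σ) X f) := by
  rw [← sub_eq_zero, wirtinger_commutator_aux, conjAlgHom_I]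
  have h : (1 : ℂ) - -σ Complex.I * σ Complex.I = 0 := by
    linear_combination algHom_I_mul_I σ
  rw [h, neg_add_cancel]
  simp

theorem wirtinger_add_conj (X : Matrix n n ℂ) (f : smoothAlg n) :
    wirtinger σ X f + wirtinger (conjAlgHom σ) X f = leftField X f := by
  rw [wirtinger_def, wirtinger_def, conjAlgHom_I]
  module

theorem translateLeft_wirtinger (y : GL n ℂ) (X : Matrix n n ℂ) (f : smoothAlg n) :
    translateLeft y (wirtinger σ X f) =
      wirtinger σ ((y⁻¹ : GL n ℂ).1 * X * y.1) (translateLeft y f) := by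
  simp only [wirtinger_def, map_smul, map_sub, translateLeft_leftField, Matrix.mul_smul,
    Matrix.smul_mul]

end Wirtinger

end LeftFields

/-! ### Continuity of differential operators -/

section Continuity

attribute [local instance] Matrix.normedAddCommGroup Matrix.normedSpace

theorem norm_iteratedFDeriv_neg_fderiv_clm_le {E : Type*} [NormedAddCommGroup E] [NormedSpace ℝ E]
    {F : E → ℂ} {s : Set E} (hs : IsOpen s) (hF : ContDiffOn ℝ ∞ F s) (A : E →L[ℝ] E)
    {x : E} (hx : x ∈ s) (m : ℕ) :
    ‖iteratedFDeriv ℝ m (fun y => -fderiv ℝ F y (A y)) x‖ ≤ ∑ i ∈ Finset.range (m + 1),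
      (m.choose i : ℝ) * ‖iteratedFDeriv ℝ (i + 1) F x‖ * ‖iteratedFDeriv ℝ (m - i) A x‖ := by
  have h := norm_iteratedFDerivWithin_clm_apply (N := ∞) (n := m)
    (hF.fderiv_of_isOpen hs (m := ∞) (by simp)) A.contDiff.contDiffOn hs.uniqueDiffOn hx
    (by exact_mod_cast le_top)
  rw [iteratedFDerivWithin_of_isOpen m hs hx] at h
  have hneg : iteratedFDeriv ℝ m (fun y => -fderiv ℝ F y (A y)) x =
      -iteratedFDeriv ℝ m (fun y => fderiv ℝ F y (A y)) x := iteratedFDeriv_neg_apply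
  rw [hneg, norm_neg]
  refine h.trans (le_of_eq (Finset.sum_congr rfl fun i _ => ?_))
  rw [iteratedFDerivWithin_of_isOpen i hs hx, iteratedFDerivWithin_of_isOpen _ hs hx,
    norm_iteratedFDeriv_fderiv]

/-- On a compact set, the Leibniz rule bounds the derivatives of order `m` of the function
`y ↦ -DF(y)(A y)` by those of `F` of order at most `m + 1`. -/
theorem exists_bound_iteratedFDeriv_neg_fderiv_clm {E : Type*} [NormedAddCommGroup E]
    [NormedSpace ℝ E] {s K : Set E} (hs : IsOpen s) (hK : IsCompact K) (hKs : K ⊆ s)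
    (A : E →L[ℝ] E) (m : ℕ) :
    ∃ C : ℝ, 0 ≤ C ∧ ∀ (F : E → ℂ) (B : ℝ), ContDiffOn ℝ ∞ F s →
      (∀ j ≤ m + 1, ∀ x ∈ K, ‖iteratedFDeriv ℝ j F x‖ ≤ B) →
      ∀ x ∈ K, ‖iteratedFDeriv ℝ m (fun y => -fderiv ℝ F y (A y)) x‖ ≤ C * B := by
  have hc : Continuous fun x => ∑ i ∈ Finset.range (m + 1),
      (m.choose i : ℝ) * ‖iteratedFDeriv ℝ (m - i) A x‖ := by
    refine continuous_finsetSum _ fun i _ => continuous_const.mul (Continuous.norm ?_)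
    exact A.contDiff.continuous_iteratedFDeriv (n := (m - i : ℕ)) le_rfl
  obtain ⟨C, hC⟩ := hK.exists_bound_of_continuousOn hc.continuousOn
  refine ⟨|C|, abs_nonneg C, fun F B hF hB x hx => ?_⟩
  have hB0 : 0 ≤ B := (norm_nonneg _).trans (hB 0 (Nat.zero_le _) x hx)
  refine (norm_iteratedFDeriv_neg_fderiv_clm_le hs hF A (hKs hx) m).trans ?_
  calc _ ≤ ∑ i ∈ Finset.range (m + 1),
        ((m.choose i : ℝ) * ‖iteratedFDeriv ℝ (m - i) A x‖) * B := by
        refine Finset.sum_le_sum fun i hi => ?_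
        rw [mul_right_comm]
        have := hB (i + 1) (by simpa using hi) x hx
        gcongr
    _ = (∑ i ∈ Finset.range (m + 1),
        (m.choose i : ℝ) * ‖iteratedFDeriv ℝ (m - i) A x‖) * B := by rw [Finset.sum_mul]
    _ ≤ |C| * B := by
        gcongr
        exact (le_abs_self _).trans ((hC x hx).trans (le_abs_self C))

variable {n : Type} [Fintype n] [DecidableEq n]

/-- A linear operator `A` on smooth functions is locally bounded if, for every compact set `K` and
every `m`, the supremum of `‖D^m (A f)‖` over `K` is at most a constant times the largest of
finitely many of the suprema of `‖D^j f‖` over the same `K`. -/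
def IsLocallyBounded (A : Module.End ℂ (smoothAlg n)) : Prop :=
  ∀ K : Set (Matrix n n ℂ), IsCompact K → K ⊆ glSet n → ∀ m : ℕ, ∃ (M : ℕ) (C : ℝ), 0 ≤ C ∧
    ∀ (f : smoothAlg n) (B : ℝ), (∀ j ≤ M, ∀ x ∈ K, ‖iteratedFDeriv ℝ j (ext f.1) x‖ ≤ B) →
      ∀ x ∈ K, ‖iteratedFDeriv ℝ m (ext (A f).1) x‖ ≤ C * B

theorem iteratedFDeriv_ext_add (f g : smoothAlg n) {x : Matrix n n ℂ} (hx : x ∈ glSet n) (m : ℕ) :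
    iteratedFDeriv ℝ m (ext (f + g).1) x =
      iteratedFDeriv ℝ m (ext f.1) x + iteratedFDeriv ℝ m (ext g.1) x := by
  obtain ⟨u, rfl⟩ := hx
  have h : ext (f + g : smoothAlg n).1 = ext f.1 + ext g.1 := by
    funext x
    by_cases hx : IsUnit x <;> simp [ext, hx]
  rw [h]
  exact iteratedFDeriv_add_apply ((contDiffAt_ext f u).of_le (by exact_mod_cast le_top))
    ((contDiffAt_ext g u).of_le (by exact_mod_cast le_top))

theorem iteratedFDeriv_ext_smul (c : ℂ) (f : smoothAlg n) {x : Matrix n n ℂ} (hx : x ∈ glSet n)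
    (m : ℕ) :
    iteratedFDeriv ℝ m (ext (c • f).1) x = c • iteratedFDeriv ℝ m (ext f.1) x := by
  obtain ⟨u, rfl⟩ := hx
  have h : ext (c • f : smoothAlg n).1 = c • ext f.1 := by
    funext x
    by_cases hx : IsUnit x <;> simp [ext, hx]
  rw [h]
  exact iteratedFDeriv_const_smul_apply ((contDiffAt_ext f u).of_le (by exact_mod_cast le_top))

theorem isLocallyBounded_leftField (X : Matrix n n ℂ) :
    IsLocallyBounded (leftField X : smoothAlg n →ₗ[ℂ] smoothAlg n) := by
  intro K hK hKs m
  obtain ⟨C, hC0, hC⟩ :=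
    exists_bound_iteratedFDeriv_neg_fderiv_clm isOpen_glSet hK hKs (mulLeftCLM X) m
  refine ⟨m + 1, C, hC0, fun f B hB x hx => ?_⟩
  obtain ⟨u, hu⟩ := hKs hx
  have h := ((ext_leftField_eventuallyEq X f u).iteratedFDeriv (𝕜 := ℝ) m).eq_of_nhds
  rw [hu] at h
  refine (congrArg norm h).trans_le ?_
  exact hC (ext f.1) B f.2 hB x hx

namespace IsLocallyBounded

variable {A A' : Module.End ℂ (smoothAlg n)}

theorem add (h : IsLocallyBounded A) (h' : IsLocallyBounded A') : IsLocallyBounded (A + A') := by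
  intro K hK hKs m
  obtain ⟨M, C, hC0, hC⟩ := h K hK hKs m
  obtain ⟨M', C', hC0', hC'⟩ := h' K hK hKs m
  refine ⟨max M M', C + C', by positivity, fun f B hB x hx => ?_⟩
  rw [LinearMap.add_apply, iteratedFDeriv_ext_add _ _ (hKs hx), add_mul]
  exact (norm_add_le _ _).trans (add_le_add
    (hC f B (fun j hj => hB j (hj.trans (le_max_left _ _))) x hx)
    (hC' f B (fun j hj => hB j (hj.trans (le_max_right _ _))) x hx))

theorem smul (c : ℂ) (h : IsLocallyBounded A) : IsLocallyBounded (c • A) := by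
  intro K hK hKs m
  obtain ⟨M, C, hC0, hC⟩ := h K hK hKs m
  refine ⟨M, ‖c‖ * C, by positivity, fun f B hB x hx => ?_⟩
  rw [LinearMap.smul_apply, iteratedFDeriv_ext_smul _ _ (hKs hx), norm_smul, mul_assoc]
  exact mul_le_mul_of_nonneg_left (hC f B hB x hx) (norm_nonneg c)

theorem one : IsLocallyBounded (1 : Module.End ℂ (smoothAlg n)) := fun _ _ _ m =>
  ⟨m, 1, zero_le_one, fun _ B hB x hx => by simpa using hB m le_rfl x hx⟩

theorem mul (h : IsLocallyBounded A) (h' : IsLocallyBounded A') : IsLocallyBounded (A * A') := by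
  intro K hK hKs m
  obtain ⟨M, C, hC0, hC⟩ := h K hK hKs m
  choose M' C' hC0' hC' using h' K hK hKs
  refine ⟨(Finset.range (M + 1)).sup M', C * ∑ j ∈ Finset.range (M + 1), C' j,
    mul_nonneg hC0 (Finset.sum_nonneg fun j _ => hC0' j), fun f B hB x hx => ?_⟩
  have hB0 : 0 ≤ B := (norm_nonneg _).trans (hB 0 (Nat.zero_le _) x hx)
  rw [mul_assoc]
  refine hC (A' f) _ (fun j hj y hy => ?_) x hx
  have hj' : j ∈ Finset.range (M + 1) := Finset.mem_range.2 (Nat.lt_succ_of_le hj)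
  refine (hC' j f B (fun l hl => hB l (hl.trans (Finset.le_sup (f := M') hj'))) y hy).trans ?_
  exact mul_le_mul_of_nonneg_right
    (Finset.single_le_sum (f := C') (fun j _ => hC0' j) hj') hB0

theorem aeval {ι : Type*} (ev : MvPolynomial ι ℂ →ₐ[ℂ] Module.End ℂ (smoothAlg n))
    (h : ∀ a, IsLocallyBounded (ev (MvPolynomial.X a))) (P : MvPolynomial ι ℂ) :
    IsLocallyBounded (ev P) := by
  induction P using MvPolynomial.induction_on with
  | C c =>
    rw [← MvPolynomial.algebraMap_eq, AlgHom.commutes, Algebra.algebraMap_eq_smul_one]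
    exact one.smul c
  | add p q hp hq => rw [map_add]; exact hp.add hq
  | mul_X p a hp => rw [map_mul]; exact hp.mul (h a)

/-- Continuity is proved at each point instead of at `0` only: `f ↦ iteratedFDeriv ℝ m (ext f)` need
not be additive off `glSet n`, so that the topology is not visibly one of a topological group. -/
theorem continuous (h : IsLocallyBounded A) :
    Continuous fun f : SmoothFun n => (show SmoothFun n from A (show smoothAlg n from f)) := by
  refine continuous_iInf_rng.2 fun m => continuous_induced_rng.2 ?_
  refine continuous_iff_continuousAt.2 fun f₀ => ?_
  refine UniformOnFun.tendsto_iff_tendstoUniformlyOn.2 fun K hK => ?_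
  refine Metric.tendstoUniformlyOn_iff.2 fun ε hε => ?_
  obtain ⟨M, C, hC0, hC⟩ := h K hK.1 hK.2 m
  have hev : ∀ j : ℕ, ∀ᶠ f : SmoothFun n in nhds f₀, ∀ x ∈ K,
      dist (iteratedFDeriv ℝ j (ext f₀.1) x) (iteratedFDeriv ℝ j (ext f.1) x) < ε / (C + 1) := by
    intro j
    have hc : Continuous fun f : SmoothFun n =>
        UniformOnFun.ofFun {K : Set (Matrix n n ℂ) | IsCompact K ∧ K ⊆ glSet n}
          (iteratedFDeriv ℝ j (ext f.1)) :=
      continuous_iff_le_induced.2 (iInf_le _ j)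
    exact Metric.tendstoUniformlyOn_iff.1
      (UniformOnFun.tendsto_iff_tendstoUniformlyOn.1 hc.continuousAt K hK) _ (by positivity)
  have hev' : ∀ᶠ f : SmoothFun n in nhds f₀, ∀ j ∈ Finset.range (M + 1), ∀ x ∈ K,
      dist (iteratedFDeriv ℝ j (ext f₀.1) x) (iteratedFDeriv ℝ j (ext f.1) x) < ε / (C + 1) :=
    (Filter.eventually_all_finset _).2 fun j _ => hev j
  filter_upwards [hev'] with f hf x hx
  let F₀ : smoothAlg n := f₀
  let F : smoothAlg n := f
  have hd : ∀ (G₀ G : smoothAlg n) (j : ℕ) (y : Matrix n n ℂ), y ∈ K →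
      dist (iteratedFDeriv ℝ j (ext G₀.1) y) (iteratedFDeriv ℝ j (ext G.1) y) =
        ‖iteratedFDeriv ℝ j (ext (G₀ + (-1 : ℂ) • G).1) y‖ := by
    intro G₀ G j y hy
    rw [iteratedFDeriv_ext_add _ _ (hK.2 hy), iteratedFDeriv_ext_smul _ _ (hK.2 hy), neg_one_smul,
      ← sub_eq_add_neg, dist_eq_norm]
  have hb := hC (F₀ + (-1 : ℂ) • F) (ε / (C + 1)) (fun j hj y hy => by
    rw [← hd F₀ F j y hy]
    exact (hf j (Finset.mem_range.2 (Nat.lt_succ_of_le hj)) y hy).le) x hx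
  rw [map_add, map_smul, ← hd _ _ m x hx] at hb
  refine lt_of_le_of_lt hb ?_
  rw [mul_div_assoc', div_lt_iff₀ (by positivity)]
  nlinarith

end IsLocallyBounded

theorem isLocallyBounded_wirtinger (σ : ℂ →ₐ[ℝ] ℂ) (X : Matrix n n ℂ) :
    IsLocallyBounded (wirtinger σ X : smoothAlg n →ₗ[ℂ] smoothAlg n) := by
  have h := ((isLocallyBounded_leftField X).add
    ((isLocallyBounded_leftField (Complex.I • X)).smul (-σ Complex.I))).smul (1 / 2)
  refine (congrArg IsLocallyBounded (LinearMap.ext fun f => ?_)).mp h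
  change (1 / 2 : ℂ) • (leftField X f + (-σ Complex.I) • leftField (Complex.I • X) f) =
    wirtinger σ X f
  rw [wirtinger_def, neg_smul, sub_eq_add_neg]

end Continuity

/-! ### Equivariance under the parabolic subgroup -/

section Equivariance

attribute [local instance] Matrix.normedAddCommGroup Matrix.normedSpace

variable {k : ℕ} (σ : ℂ →ₐ[ℝ] ℂ)

/-- The operators `L_E` for the matrix units `E` of `𝔤𝔩_{2k}(ℂ)`, complexified along `σ`. -/
def unitField (I J : Fin k ⊕ Fin k) : Module.End ℂ (smoothAlg (Fin k ⊕ Fin k)) :=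
  (wirtinger σ (Matrix.single I J 1) : smoothAlg (Fin k ⊕ Fin k) →ₗ[ℂ] smoothAlg (Fin k ⊕ Fin k))

theorem unitField_apply (I J : Fin k ⊕ Fin k) (f : smoothAlg (Fin k ⊕ Fin k)) :
    unitField σ I J f = wirtinger σ (Matrix.single I J 1) f := rfl

theorem wirtinger_single_mul_single (I J K L : Fin k ⊕ Fin k) (f : smoothAlg (Fin k ⊕ Fin k)) :
    wirtinger σ (Matrix.single I J 1 * Matrix.single K L 1) f =
      (if J = K then unitField σ I L else 0) f := by
  split_ifs with h
  · subst h
    rw [Matrix.single_mul_single_same, mul_one, unitField_apply]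
  · rw [Matrix.single_mul_single_of_ne _ _ _ _ h]
    simpa using wirtinger_smul σ 0 (0 : Matrix (Fin k ⊕ Fin k) (Fin k ⊕ Fin k) ℂ) f

theorem isMatrixUnitRep_unitField : IsMatrixUnitRep (unitField (k := k) σ) := by
  intro I J K L
  refine LinearMap.ext fun f => ?_
  rw [LinearMap.sub_apply, LinearMap.sub_apply, Module.End.mul_apply, Module.End.mul_apply,
    unitField_apply, unitField_apply, unitField_apply, unitField_apply, wirtinger_commutator,
    ← wirtinger_single_mul_single, ← wirtinger_single_mul_single,
    eq_sub_iff_add_eq, ← wirtinger_add, sub_add_cancel]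

theorem exists_lowerAlg : ∃ ev : MvPolynomial (Fin k × Fin k) ℂ →ₐ[ℂ]
    Module.End ℂ (smoothAlg (Fin k ⊕ Fin k)),
    ∀ a, ev (MvPolynomial.X a) = unitField σ (Sum.inr a.1) (Sum.inl a.2) := by
  refine exists_aeval_of_commute
    (fun a : Fin k × Fin k => unitField σ (Sum.inr a.1) (Sum.inl a.2)) fun a b => ?_
  exact (isMatrixUnitRep_unitField σ).mul_comm_of_ne Sum.inl_ne_inr Sum.inl_ne_inr

/-- The constant-coefficient differential operators in the directions of the opposite
nilradical: the polynomial `P` goes to `P(∂)`, where `∂ = (∂_{rs})` are the commuting operators of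
the lower left matrix units. -/
def lowerAlg : MvPolynomial (Fin k × Fin k) ℂ →ₐ[ℂ] Module.End ℂ (smoothAlg (Fin k ⊕ Fin k)) :=
  (exists_lowerAlg σ).choose

theorem lowerAlg_X (a : Fin k × Fin k) :
    lowerAlg σ (MvPolynomial.X a) = unitField σ (Sum.inr a.1) (Sum.inl a.2) :=
  (exists_lowerAlg σ).choose_spec a

/-- Transformation of `f` by a factor depending on the diagonal blocks, under left
translations from the parabolic subgroup. -/
def IsEquivariant (χ : GL (Fin k) ℂ → GL (Fin k) ℂ → ℂ) (f : GL (Fin k ⊕ Fin k) ℂ → ℂ) : Prop :=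
  ∀ (a : GL (Fin k) ℂ) (b : Matrix (Fin k) (Fin k) ℂ) (d : GL (Fin k) ℂ)
    (x : GL (Fin k ⊕ Fin k) ℂ), f (parabolicElt a b d * x) = χ a d * f x

/-- The factor of `1 × δ^i δ̄^j`, where `δ` is the composite of `σ` and the determinant. -/
def sourceFactor (i : ℕ) (j : ℤ) (a d : GL (Fin k) ℂ) : ℂ :=
  σ d.val.det ^ i * (starRingEnd ℂ (σ d.val.det)) ^ j * (√(modular a d) : ℝ)

/-- The factor of `δ^i × δ̄^j`, where `δ` is the composite of `σ` and the determinant. -/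
def targetFactor (i : ℕ) (j : ℤ) (a d : GL (Fin k) ℂ) : ℂ :=
  σ a.val.det ^ i * (starRingEnd ℂ (σ d.val.det)) ^ j * (√(modular a d) : ℝ)

theorem hasDerivAt_det_one_sub_smul (A : Matrix (Fin k) (Fin k) ℂ) :
    HasDerivAt (fun t : ℝ => (1 - (t : ℂ) • A).det) (-A.trace) 0 := by
  have h : ∀ t : ℝ, (1 - (t : ℂ) • A).det = 1 - A.trace * t +
      ((Matrix.det (1 + (Polynomial.X : Polynomial ℂ) • A.map Polynomial.C)).divX.divX).eval
        (-(t : ℂ)) * (t : ℂ) ^ 2 := by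
    intro t
    have := Matrix.det_one_add_smul (-(t : ℂ)) A
    rw [neg_smul, ← sub_eq_add_neg] at this
    rw [this]
    ring
  simp_rw [h]
  generalize (Matrix.det (1 + (Polynomial.X : Polynomial ℂ) • A.map Polynomial.C)).divX.divX = p
  have ht : HasDerivAt (fun t : ℝ => (t : ℂ)) 1 0 := Complex.ofRealCLM.hasDerivAt
  have hp : HasDerivAt (fun t : ℝ => p.eval (-(t : ℂ)))
      (p.derivative.eval (-((0 : ℝ) : ℂ)) * -1) 0 :=
    HasDerivAt.comp (h₂ := fun z => p.eval z) (0 : ℝ) (p.hasDerivAt _) ht.fun_neg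
  have := ((ht.const_mul A.trace).const_sub 1).add (hp.mul (ht.pow 2))
  refine this.congr_deriv ?_
  simp

theorem hasDerivAt_det_one_sub_smul_normSq_pow (A : Matrix (Fin k) (Fin k) ℂ) (m : ℕ) :
    HasDerivAt (fun t : ℝ => (‖(1 - (t : ℂ) • A).det‖ ^ 2) ^ m) (-(2 * m * A.trace.re)) 0 := by
  have h := (hasDerivAt_det_one_sub_smul A).norm_sq.pow m
  refine h.congr_deriv ?_
  simp [Complex.inner]
  ring

theorem hasDerivAt_sourceFactor_curve (i : ℕ) (j : ℤ) (A D : Matrix (Fin k) (Fin k) ℂ) :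
    HasDerivAt (fun t : ℝ => σ (1 - (t : ℂ) • D).det ^ i *
      (starRingEnd ℂ (σ (1 - (t : ℂ) • D).det)) ^ j *
      ((√((‖(1 - (t : ℂ) • A).det‖ ^ 2) ^ k * ((‖(1 - (t : ℂ) • D).det‖ ^ 2) ^ k)⁻¹) : ℝ) : ℂ))
      (-(i * σ D.trace + j * starRingEnd ℂ (σ D.trace) + k * (A.trace.re - D.trace.re))) 0 := by
  have hu := hasDerivAt_det_one_sub_smul D
  have hσ : HasDerivAt (fun t : ℝ => σ (1 - (t : ℂ) • D).det) (σ (-D.trace)) 0 :=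
    (LinearMap.toContinuousLinearMap σ.toLinearMap).hasFDerivAt.comp_hasDerivAt (0 : ℝ) hu
  have hσ' : HasDerivAt (fun t : ℝ => starRingEnd ℂ (σ (1 - (t : ℂ) • D).det))
      (starRingEnd ℂ (σ (-D.trace))) 0 :=
    Complex.conjCLE.toContinuousLinearMap.hasFDerivAt.comp_hasDerivAt (0 : ℝ) hσ
  have h1 := hσ.pow i
  have h2 : HasDerivAt (fun t : ℝ => (starRingEnd ℂ (σ (1 - (t : ℂ) • D).det)) ^ j) _ 0 :=
    HasDerivAt.comp (h₂ := fun z : ℂ => z ^ j) (0 : ℝ) (hasDerivAt_zpow j _ (by simp)) hσ'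
  have h3 := ((hasDerivAt_det_one_sub_smul_normSq_pow A k).mul
    ((hasDerivAt_det_one_sub_smul_normSq_pow D k).inv (by simp))).sqrt (by simp)
  have h4 := (h1.mul h2).mul h3.ofReal_comp
  refine h4.congr_deriv ?_
  simp
  ring

theorem one_sub_fromBlocks (A B C D : Matrix (Fin k) (Fin k) ℂ) :
    1 - Matrix.fromBlocks A B C D = Matrix.fromBlocks (1 - A) (-B) (-C) (1 - D) := by
  ext (i | i) (j | j) <;> simp [Matrix.one_apply]

/-- The Lie algebra of the parabolic subgroup acts on the functions of the source by minus the
differential of the character `δ^i(d) δ̄^j(d) |det a|^k |det d|^{-k}`. -/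
theorem leftField_apply_of_isEquivariant {i : ℕ} {j : ℤ} (f : smoothAlg (Fin k ⊕ Fin k))
    (hf : IsEquivariant (sourceFactor σ i j) f.1) (A B D : Matrix (Fin k) (Fin k) ℂ) :
    leftField (Matrix.fromBlocks A B 0 D) f =
      (-(i * σ D.trace + j * starRingEnd ℂ (σ D.trace) + k * (A.trace.re - D.trace.re)) : ℂ) • f := by
  refine smoothAlg_ext fun x => ?_
  set X := Matrix.fromBlocks A B 0 D with hX
  have h := hasDerivAt_leftField X f x (by simp) (hasDerivAt_sub_smul x.1 (X * x.1) 0)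
  have hg := (hasDerivAt_sourceFactor_curve σ i j A D).mul_const (f.1 x)
  refine h.unique (hg.congr_of_eventuallyEq ?_)
  have hA : ∀ᶠ t : ℝ in nhds 0, (1 - (t : ℂ) • A).det ≠ 0 :=
    (hasDerivAt_det_one_sub_smul A).continuousAt.eventually_ne (by simp)
  have hD : ∀ᶠ t : ℝ in nhds 0, (1 - (t : ℂ) • D).det ≠ 0 :=
    (hasDerivAt_det_one_sub_smul D).continuousAt.eventually_ne (by simp)
  filter_upwards [hA, hD] with t ha hd
  obtain ⟨a, ha'⟩ := (Matrix.isUnit_iff_isUnit_det _).2 ha.isUnit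
  obtain ⟨d, hd'⟩ := (Matrix.isUnit_iff_isUnit_det _).2 hd.isUnit
  have hy : x.1 - t • (X * x.1) = (parabolicElt a (-((t : ℂ) • B)) d * x).1 := by
    have hp : (parabolicElt a (-((t : ℂ) • B)) d).1 = 1 - (t : ℂ) • X := by
      change Matrix.fromBlocks a.val (-((t : ℂ) • B)) 0 d.val = _
      rw [ha', hd', hX, Matrix.fromBlocks_smul, one_sub_fromBlocks]
      simp
    rw [Units.val_mul, hp, sub_mul, one_mul, Matrix.smul_mul]
    rfl
  change ext f.1 (x.1 - t • (X * x.1)) = _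
  rw [hy, ext_val, hf, sourceFactor, hd', ← ha', ← hd']
  rfl

theorem wirtinger_apply_of_isEquivariant {i : ℕ} {j : ℤ} (f : smoothAlg (Fin k ⊕ Fin k))
    (hf : IsEquivariant (sourceFactor σ i j) f.1) (A B D : Matrix (Fin k) (Fin k) ℂ) :
    wirtinger σ (Matrix.fromBlocks A B 0 D) f =
      (-((i - k / 2) * σ D.trace + k / 2 * σ A.trace)) • f := by
  have hI := algHom_I_mul_I σ
  have hconj : starRingEnd ℂ (σ Complex.I) = -σ Complex.I := conjAlgHom_I σ
  -- The modulus contributes half a trace to the `σ`-linear part.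
  have hre : ∀ c : ℂ, (c.re : ℂ) = (σ c + starRingEnd ℂ (σ c)) / 2 := by
    intro c
    rw [algHom_eq σ c, map_add, map_mul, hconj, Complex.conj_ofReal, Complex.conj_ofReal]
    ring
  rw [wirtinger_def, Matrix.fromBlocks_smul, smul_zero,
    leftField_apply_of_isEquivariant σ f hf, leftField_apply_of_isEquivariant σ f hf, hre, hre, hre,
    hre]
  simp only [Matrix.trace_smul, smul_eq_mul, map_mul, hconj]
  match_scalars
  linear_combination (1 / 2 * (i * σ D.trace - j * starRingEnd ℂ (σ D.trace)
    + k / 2 * (σ A.trace - starRingEnd ℂ (σ A.trace) - σ D.trace + starRingEnd ℂ (σ D.trace)))) * hI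

theorem single_inl_inl (a b : Fin k) (c : ℂ) : Matrix.single (Sum.inl a) (Sum.inl b) c =
    (Matrix.fromBlocks (Matrix.single a b c) 0 0 0 :
      Matrix (Fin k ⊕ Fin k) (Fin k ⊕ Fin k) ℂ) := by
  ext (i | i) (j | j) <;> simp [Matrix.single_apply]

theorem single_inl_inr (a b : Fin k) (c : ℂ) : Matrix.single (Sum.inl a) (Sum.inr b) c =
    (Matrix.fromBlocks 0 (Matrix.single a b c) 0 0:
      Matrix (Fin k ⊕ Fin k) (Fin k ⊕ Fin k) ℂ) := by
  ext (i | i) (j | j) <;> simp [Matrix.single_apply]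

theorem single_inr_inl (a b : Fin k) (c : ℂ) : Matrix.single (Sum.inr a) (Sum.inl b) c =
    (Matrix.fromBlocks 0 0 (Matrix.single a b c) 0:
      Matrix (Fin k ⊕ Fin k) (Fin k ⊕ Fin k) ℂ) := by
  ext (i | i) (j | j) <;> simp [Matrix.single_apply]

theorem single_inr_inr (a b : Fin k) (c : ℂ) : Matrix.single (Sum.inr a) (Sum.inr b) c =
    (Matrix.fromBlocks 0 0 0 (Matrix.single a b c):
      Matrix (Fin k ⊕ Fin k) (Fin k ⊕ Fin k) ℂ) := by
  ext (i | i) (j | j) <;> simp [Matrix.single_apply]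

theorem trace_single_one (a b : Fin k) :
    (Matrix.single a b (1 : ℂ)).trace = if a = b then 1 else 0 := by
  split_ifs with h
  · subst h
    simp
  · exact Matrix.trace_single_eq_of_ne _ _ _ h

theorem unitField_upper_lowerAlg {i : ℕ} {j : ℤ} (f : smoothAlg (Fin k ⊕ Fin k))
    (hf : IsEquivariant (sourceFactor σ i j) f.1) (a b : Fin k) :
    unitField σ (Sum.inl a) (Sum.inr b) (lowerAlg σ (genericDet k ^ i) f) = 0 := by
  refine upper_aeval_genericDet_pow (isMatrixUnitRep_unitField σ)
    (fun r s => lowerAlg_X σ (r, s)) f (k / 2) (k / 2 - i) i (by ring) ?_ ?_ ?_ a b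
  · intro a b
    rw [unitField_apply, single_inl_inr, wirtinger_apply_of_isEquivariant σ f hf]
    simp
  · intro a b
    rw [unitField_apply, single_inl_inl, wirtinger_apply_of_isEquivariant σ f hf, trace_single_one]
    split_ifs <;> simp
  · intro a b
    rw [unitField_apply, single_inr_inr, wirtinger_apply_of_isEquivariant σ f hf, trace_single_one]
    split_ifs <;> simp

theorem wirtinger_eq_sum_unitField (X : Matrix (Fin k ⊕ Fin k) (Fin k ⊕ Fin k) ℂ)
    (f : smoothAlg (Fin k ⊕ Fin k)) :
    wirtinger σ X f = ∑ I, ∑ J, σ (X I J) • unitField σ I J f := by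
  conv_lhs => rw [Matrix.matrix_eq_sum_single X, wirtinger_sum]
  refine Finset.sum_congr rfl fun I _ => ?_
  rw [wirtinger_sum]
  refine Finset.sum_congr rfl fun J _ => ?_
  rw [unitField_apply, ← wirtinger_smul, Matrix.smul_single, smul_eq_mul, mul_one]

theorem leftField_upper_lowerAlg {i : ℕ} {j : ℤ} (f : smoothAlg (Fin k ⊕ Fin k))
    (hf : IsEquivariant (sourceFactor σ i j) f.1) (B : Matrix (Fin k) (Fin k) ℂ) :
    leftField (Matrix.fromBlocks 0 B 0 0) (lowerAlg σ (genericDet k ^ i) f) = 0 := by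
  have h1 : wirtinger σ (Matrix.fromBlocks 0 B 0 0) (lowerAlg σ (genericDet k ^ i) f) = 0 := by
    rw [wirtinger_eq_sum_unitField]
    simp only [Fintype.sum_sum_type, Matrix.fromBlocks_apply₁₁, Matrix.fromBlocks_apply₁₂,
      Matrix.fromBlocks_apply₂₁, Matrix.fromBlocks_apply₂₂, Matrix.zero_apply, map_zero, zero_smul,
      Finset.sum_const_zero, add_zero, unitField_upper_lowerAlg σ f hf, smul_zero]
  have h0 : wirtinger σ (Matrix.fromBlocks 0 B 0 0) f = 0 := by
    rw [wirtinger_apply_of_isEquivariant σ f hf]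
    simp
  have h0' : wirtinger (conjAlgHom σ) (Matrix.fromBlocks 0 B 0 0) f = 0 := by
    have h := wirtinger_add_conj σ (Matrix.fromBlocks 0 B 0 0) f
    rw [h0, zero_add, leftField_apply_of_isEquivariant σ f hf] at h
    rw [h]
    simp
  have h2 : wirtinger (conjAlgHom σ) (Matrix.fromBlocks 0 B 0 0)
      (lowerAlg σ (genericDet k ^ i) f) = 0 := by
    let H : Module.End ℂ (smoothAlg (Fin k ⊕ Fin k)) :=
      (wirtinger (conjAlgHom σ) (Matrix.fromBlocks 0 B 0 0)).toLinearMap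
    have h := commutator_aeval (lowerAlg (k := k) σ) H 0 (by
      intro a
      rw [Derivation.zero_apply, map_zero, add_zero, lowerAlg_X]
      exact LinearMap.ext fun f => wirtinger_conj_commute σ _ _ f) (genericDet k ^ i)
    have h' := LinearMap.congr_fun h f
    rw [Derivation.zero_apply, map_zero, add_zero] at h'
    refine h'.trans ?_
    change lowerAlg σ (genericDet k ^ i) (wirtinger (conjAlgHom σ) _ f) = 0
    rw [h0', map_zero]
  rw [← wirtinger_add_conj σ, h1, h2, add_zero]

/-- Invariance under the upper unipotent group is the vanishing of the derivative along the lines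
`t ↦ (1 - tX) x`, on which the vector field `X` is constant since `X² = 0`. -/
theorem apply_upper_mul_of_leftField_eq_zero (F : smoothAlg (Fin k ⊕ Fin k))
    (B : Matrix (Fin k) (Fin k) ℂ) (hF : leftField (Matrix.fromBlocks 0 B 0 0) F = 0)
    (x : GL (Fin k ⊕ Fin k) ℂ) : F.1 (parabolicElt 1 B 1 * x) = F.1 x := by
  set X : Matrix (Fin k ⊕ Fin k) (Fin k ⊕ Fin k) ℂ := Matrix.fromBlocks 0 B 0 0 with hX
  have hXX : X * X = 0 := by
    rw [hX, Matrix.fromBlocks_multiply]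
    simp
  have hp : ∀ t : ℝ, x.1 - t • (X * x.1) = (parabolicElt 1 (-((t : ℂ) • B)) 1 * x).1 := by
    intro t
    have hp : (parabolicElt 1 (-((t : ℂ) • B)) 1).1 = 1 - (t : ℂ) • X := by
      change Matrix.fromBlocks 1 (-((t : ℂ) • B)) 0 1 = _
      rw [hX, Matrix.fromBlocks_smul, one_sub_fromBlocks]
      simp
    rw [Units.val_mul, hp, sub_mul, one_mul, Matrix.smul_mul]
    rfl
  have hd : ∀ t : ℝ, HasDerivAt (fun s : ℝ => ext F.1 (x.1 - s • (X * x.1))) 0 t := by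
    intro t
    have hγ : HasDerivAt (fun s : ℝ => x.1 - s • (X * x.1)) (-(X * (x.1 - t • (X * x.1)))) t := by
      rw [mul_sub, Matrix.mul_smul, ← Matrix.mul_assoc, hXX, zero_mul, smul_zero, sub_zero]
      exact hasDerivAt_sub_smul x.1 (X * x.1) t
    rw [hp t] at hγ
    have h := hasDerivAt_leftField X F _ (hp t) hγ
    rw [hF] at h
    exact h
  have hc := is_const_of_deriv_eq_zero (fun t => (hd t).differentiableAt)
    (fun t => (hd t).deriv) (-1) 0
  simp only [hp] at hc
  rw [ext_val, ext_val] at hc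
  have e1 : parabolicElt 1 (-(((-1 : ℝ) : ℂ) • B)) 1 = parabolicElt 1 B 1 := by
    congr 1
    simp
  have e0 : parabolicElt 1 (-(((0 : ℝ) : ℂ) • B)) 1 * x = x := by
    refine Units.ext ?_
    rw [← hp]
    simp
  rwa [e1, e0] at hc

/-- The substitution of `Dᵀ X Aᵀ` for the generic matrix `X` in polynomials. -/
def twist (D A : Matrix (Fin k) (Fin k) ℂ) :
    MvPolynomial (Fin k × Fin k) ℂ →ₐ[ℂ] MvPolynomial (Fin k × Fin k) ℂ :=
  MvPolynomial.aeval fun a => ∑ p, ∑ q, MvPolynomial.C (D p a.1 * A a.2 q) * MvPolynomial.X (p, q)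

theorem twist_genericDet (D A : Matrix (Fin k) (Fin k) ℂ) :
    twist D A (genericDet k) = MvPolynomial.C (D.det * A.det) * genericDet k := by
  have h : (twist D A).mapMatrix (Matrix.mvPolynomialX (Fin k) (Fin k) ℂ) =
      (MvPolynomial.C.mapMatrix D).transpose * Matrix.mvPolynomialX (Fin k) (Fin k) ℂ *
        (MvPolynomial.C.mapMatrix A).transpose := by
    ext1 r s
    simp only [AlgHom.mapMatrix_apply, Matrix.map_apply, Matrix.mvPolynomialX_apply, twist,
      MvPolynomial.aeval_X, Matrix.mul_apply, Matrix.transpose_apply, RingHom.mapMatrix_apply,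
      Finset.sum_mul]
    rw [Finset.sum_comm]
    refine Finset.sum_congr rfl fun p _ => Finset.sum_congr rfl fun q _ => ?_
    rw [map_mul]
    ring
  rw [genericDet, AlgHom.map_det, h, Matrix.det_mul, Matrix.det_mul, Matrix.det_transpose,
    Matrix.det_transpose, ← RingHom.map_det, ← RingHom.map_det, map_mul]
  ring

/-- Left translation by an element of the Levi subgroup normalizes the algebra of the operators
`P(∂)`, acting on it by a linear substitution. -/
theorem translateLeft_lowerAlg (a d : GL (Fin k) ℂ) (P : MvPolynomial (Fin k × Fin k) ℂ)
    (f : smoothAlg (Fin k ⊕ Fin k)) :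
    translateLeft (parabolicElt a 0 d) (lowerAlg σ P f) =
      lowerAlg σ (twist ((d⁻¹ : GL (Fin k) ℂ).val.map σ) (a.val.map σ) P)
        (translateLeft (parabolicElt a 0 d) f) := by
  induction P using MvPolynomial.induction_on generalizing f with
  | C c =>
    rw [← MvPolynomial.algebraMap_eq, AlgHom.commutes, AlgHom.commutes, AlgHom.commutes]
    simp [Module.algebraMap_end_apply]
  | add p q hp hq =>
    simp only [map_add, LinearMap.add_apply, hp, hq]
  | mul_X P x hP =>
    obtain ⟨r, s⟩ := x
    rw [map_mul, Module.End.mul_apply, hP, map_mul, map_mul, Module.End.mul_apply]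
    congr 1
    rw [lowerAlg_X, unitField_apply, translateLeft_wirtinger, wirtinger_eq_sum_unitField]
    have hmat : ((parabolicElt a 0 d)⁻¹ : GL (Fin k ⊕ Fin k) ℂ).1 *
        Matrix.single (Sum.inr r) (Sum.inl s) 1 * (parabolicElt a 0 d).1 =
        Matrix.fromBlocks 0 0 (d⁻¹.val * Matrix.single r s 1 * a.val) 0 := by
      rw [single_inr_inl]
      change Matrix.fromBlocks a⁻¹.val (-(a⁻¹.val * 0 * d⁻¹.val)) 0 d⁻¹.val * _ *
        Matrix.fromBlocks a.val 0 0 d.val = _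
      rw [Matrix.fromBlocks_multiply, Matrix.fromBlocks_multiply]
      simp
    rw [hmat]
    have hent : ∀ p q, (d⁻¹.val * Matrix.single r s 1 * a.val : Matrix (Fin k) (Fin k) ℂ) p q =
        d⁻¹.val p r * a.val s q := by
      intro p q
      simp [Matrix.mul_apply, Matrix.single_apply, ite_and, -Matrix.coe_units_inv]
    simp only [Fintype.sum_sum_type, Matrix.fromBlocks_apply₁₁, Matrix.fromBlocks_apply₁₂,
      Matrix.fromBlocks_apply₂₁, Matrix.fromBlocks_apply₂₂, Matrix.zero_apply, map_zero, zero_smul,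
      Finset.sum_const_zero, zero_add, add_zero, hent, twist, MvPolynomial.aeval_X, map_sum,
      LinearMap.sum_apply, map_mul, Module.End.mul_apply, lowerAlg_X, Matrix.map_apply]
    refine Finset.sum_congr rfl fun p _ => Finset.sum_congr rfl fun q _ => ?_
    rw [← MvPolynomial.algebraMap_eq, AlgHom.commutes, AlgHom.commutes,
      Module.algebraMap_end_apply, Module.algebraMap_end_apply, smul_smul]

/-- `det(∂)^i` takes functions transforming as in `1 × δ^i δ̄^j` to functions transforming as in
`δ^i × δ̄^j`. -/
theorem isEquivariant_lowerAlg {i : ℕ} {j : ℤ} (f : smoothAlg (Fin k ⊕ Fin k))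
    (hf : IsEquivariant (sourceFactor σ i j) f.1) :
    IsEquivariant (targetFactor σ i j) (lowerAlg σ (genericDet k ^ i) f).1 := by
  intro a b d x
  have hdec : parabolicElt a b d = parabolicElt 1 (b * d⁻¹.val) 1 * parabolicElt a 0 d := by
    refine Units.ext ?_
    change Matrix.fromBlocks a.val b 0 d.val =
      Matrix.fromBlocks 1 (b * d⁻¹.val) 0 1 * Matrix.fromBlocks a.val 0 0 d.val
    rw [Matrix.fromBlocks_multiply]
    simp [-Matrix.coe_units_inv]
  rw [hdec, mul_assoc, apply_upper_mul_of_leftField_eq_zero _ _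
    (leftField_upper_lowerAlg σ f hf _), ← translateLeft_apply, translateLeft_lowerAlg]
  -- The factor `(σ(det d)⁻¹ σ(det a))^i` turns the source factor into the target factor.
  have htr : translateLeft (parabolicElt a 0 d) f = sourceFactor σ i j a d • f :=
    smoothAlg_ext fun x => hf a 0 d x
  have hmap : ∀ M : Matrix (Fin k) (Fin k) ℂ, (M.map σ).det = σ M.det := fun M =>
    (AlgHom.map_det σ M).symm
  have hd : σ (d⁻¹ : GL (Fin k) ℂ).val.det * σ d.val.det = 1 := by
    rw [← map_mul, ← Matrix.det_mul, Units.inv_mul, Matrix.det_one, map_one]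
  rw [htr, map_pow, twist_genericDet, mul_pow, ← map_pow, map_mul, Module.End.mul_apply,
    ← MvPolynomial.algebraMap_eq, AlgHom.commutes, Module.algebraMap_end_apply, map_smul, hmap, hmap]
  change (σ (d⁻¹ : GL (Fin k) ℂ).val.det * σ a.val.det) ^ i * (sourceFactor σ i j a d * _) = _
  have hd' : σ (d⁻¹ : GL (Fin k) ℂ).val.det ^ i * σ d.val.det ^ i = 1 := by
    rw [← mul_pow, hd, one_pow]
  rw [sourceFactor, targetFactor, mul_pow]
  linear_combination (σ a.val.det ^ i * (starRingEnd ℂ (σ d.val.det)) ^ j *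
    (√(modular a d) : ℝ) * (lowerAlg σ (genericDet k ^ i) f).1 x) * hd'

end Equivariance

/-! ### The pairing of polynomials with differential operators -/

section Pairing

open MvPolynomial

theorem derivation_aeval {ι A : Type*} [Fintype ι] [DecidableEq ι] [CommRing A] [Algebra ℂ A]
    (D : Derivation ℂ A A) (c : ι → A) (P : MvPolynomial ι ℂ) :
    D (aeval c P) = ∑ b, aeval c (pderiv b P) * D (c b) := by
  induction P using MvPolynomial.induction_on with
  | C a => simp
  | add p q hp hq => simp only [map_add, hp, hq, add_mul, Finset.sum_add_distrib]
  | mul_X p a hp =>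
    simp only [map_mul, aeval_X, Derivation.leibniz, hp, smul_eq_mul, map_add, add_mul,
      Finset.sum_add_distrib, pderiv_X, Pi.single_apply]
    congr 1
    · simp [ite_mul, apply_ite]
    · rw [Finset.mul_sum]
      exact Finset.sum_congr rfl fun b _ => by ring

/-- Let the functions `c b` vanish at the point `ε`, and let `W a (c b)` be there `-1` if `a = b` and
`0` otherwise. Then, at `ε`, the differential operator `W ^ α` kills the multiples of all monomials
`c ^ β ≠ c ^ α` whose degree is at least that of `α`. -/
theorem eval_monomial_mul {ι A : Type*} [Fintype ι] [DecidableEq ι] [CommRing A] [Algebra ℂ A]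
    (ε : A →ₐ[ℂ] ℂ) (W : ι → Derivation ℂ A A) (ev : MvPolynomial ι ℂ →ₐ[ℂ] Module.End ℂ A)
    (hev : ∀ a x, ev (X a) x = W a x) (c : ι → A) (hc : ∀ a, ε (c a) = 0)
    (hW : ∀ a b, ε (W a (c b)) = if a = b then -1 else 0)
    (α β : ι →₀ ℕ) (h : α.degree ≤ β.degree) (q : A) :
    ε (ev (monomial α 1) (aeval c (monomial β (1 : ℂ)) * q)) =
      if α = β then (-1) ^ α.degree * ((∏ a, (α a).factorial : ℕ) : ℂ) * ε q else 0 := by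
  induction hN : α.degree generalizing α β q with
  | zero =>
    have hα : α = 0 := (Finsupp.degree_eq_zero_iff α).1 hN
    subst hα
    have h1 : ev (monomial 0 1) = 1 := map_one ev
    rw [h1, Module.End.one_apply, map_mul]
    split_ifs with hβ
    · subst hβ
      simp
    · obtain ⟨a, ha⟩ := Finsupp.ne_iff.1 (Ne.symm hβ)
      rw [aeval_monomial, map_mul, map_finsuppProd, Finsupp.prod,
        Finset.prod_eq_zero (Finsupp.mem_support_iff.2 ha), mul_zero, zero_mul]
      rw [map_pow, hc, zero_pow ha]
  | succ N ih =>
    obtain ⟨a, ha⟩ : ∃ a, α a ≠ 0 := by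
      by_contra! hcon
      have : α = 0 := Finsupp.ext hcon
      simp [this] at hN
    obtain ⟨α', rfl⟩ : ∃ α', α = α' + Finsupp.single a 1 :=
      ⟨α - Finsupp.single a 1, (tsub_add_cancel_of_le (by
        rwa [Finsupp.single_le_iff, Nat.one_le_iff_ne_zero])).symm⟩
    have hN' : α'.degree = N := by
      rw [map_add, Finsupp.degree_single] at hN
      omega
    have hmon : (monomial (α' + Finsupp.single a 1) (1 : ℂ)) = monomial α' 1 * X a := by
      rw [X, monomial_mul, mul_one]
    have hterm : ∀ b, ε (ev (monomial α' 1)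
        (aeval c (pderiv b (monomial β (1 : ℂ))) * (W a (c b) * q))) =
        if b = a then (if α' + Finsupp.single a 1 = β then
          (-1) ^ (N + 1) * ((∏ x, ((α' + Finsupp.single a 1 : ι →₀ ℕ) x).factorial : ℕ) : ℂ) * ε q
          else 0) else 0 := by
      intro b
      rw [pderiv_monomial, one_mul]
      have hsm : monomial (β - Finsupp.single b 1) ((β b : ℕ) : ℂ) =
          (β b : ℂ) • monomial (β - Finsupp.single b 1) 1 := by
        rw [smul_monomial, smul_eq_mul, mul_one]
      rw [hsm, map_smul, smul_mul_assoc, map_smul, map_smul]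
      by_cases hb0 : β b = 0
      · rw [hb0, Nat.cast_zero, zero_smul]
        split_ifs with h1 h2
        · subst h1
          rw [← h2] at hb0
          simp at hb0
        all_goals rfl
      have hle : Finsupp.single b 1 ≤ β := by
        rwa [Finsupp.single_le_iff, Nat.one_le_iff_ne_zero]
      have hdeg : (β - Finsupp.single b 1).degree + 1 = β.degree := by
        conv_rhs => rw [← tsub_add_cancel_of_le hle, map_add, Finsupp.degree_single]
      rw [ih α' (β - Finsupp.single b 1) (by omega) _ hN', map_mul, hW]
      by_cases hab : b = a
      · subst hab
        rw [if_pos rfl, if_pos rfl]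
        have hiff : α' = β - Finsupp.single b 1 ↔ α' + Finsupp.single b 1 = β :=
          eq_tsub_iff_add_eq_of_le hle
        by_cases hβ : α' + Finsupp.single b 1 = β
        · rw [if_pos (hiff.2 hβ), if_pos hβ]
          have hprod : ∏ x, ((α' + Finsupp.single b 1 : ι →₀ ℕ) x).factorial =
              β b * ∏ x, (α' x).factorial := by
            rw [← Finset.mul_prod_erase _ _ (Finset.mem_univ b),
              ← Finset.mul_prod_erase _ (fun x => (α' x).factorial) (Finset.mem_univ b), ← hβ,
              ← mul_assoc]
            congr 1
            · simp [Nat.factorial_succ]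
            · refine Finset.prod_congr rfl fun x hx => ?_
              simp [(Finset.ne_of_mem_erase hx).symm]
          rw [hprod, smul_eq_mul]
          push_cast
          ring
        · rw [if_neg (fun h => hβ (hiff.1 h)), if_neg hβ, smul_zero]
      · rw [if_neg hab, if_neg (Ne.symm hab)]
        simp
    -- The derivative `W a` hits `c ^ β` or `q`; in the second case too few derivatives remain.
    rw [hmon, map_mul ev, Module.End.mul_apply, hev, Derivation.leibniz, map_add, map_add,
      derivation_aeval, smul_eq_mul, smul_eq_mul, Finset.mul_sum, map_sum, map_sum]
    have hdeg' : α'.degree < β.degree := by omega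
    rw [ih α' β hdeg'.le _ hN', if_neg (fun h => by rw [h] at hdeg'; exact lt_irrefl _ hdeg'),
      zero_add]
    have hcomm : ∀ b, q * (aeval c (pderiv b (monomial β (1 : ℂ))) * W a (c b)) =
        aeval c (pderiv b (monomial β (1 : ℂ))) * (W a (c b) * q) := fun b => by ring
    simp only [hcomm, hterm, Finset.sum_ite_eq', Finset.mem_univ, if_true]

/-- A nonzero homogeneous polynomial `P` with integer coefficients pairs nontrivially with itself as
a differential operator: up to the factor `± ε q`, the value is the sum over `α` of `α!` times the
square of the coefficient of `P` at `α`. -/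
theorem eval_self_ne_zero {ι A : Type*} [Fintype ι] [DecidableEq ι] [CommRing A] [Algebra ℂ A]
    (ε : A →ₐ[ℂ] ℂ) (W : ι → Derivation ℂ A A) (ev : MvPolynomial ι ℂ →ₐ[ℂ] Module.End ℂ A)
    (hev : ∀ a x, ev (X a) x = W a x) (c : ι → A) (hc : ∀ a, ε (c a) = 0)
    (hW : ∀ a b, ε (W a (c b)) = if a = b then -1 else 0)
    (P : MvPolynomial ι ℤ) {N : ℕ} (hP : P.IsHomogeneous N) (hP0 : P ≠ 0) (q : A) (hq : ε q ≠ 0) :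
    ε (ev (map (Int.castRingHom ℂ) P) (aeval c (map (Int.castRingHom ℂ) P) * q)) ≠ 0 := by
  have hsum : map (Int.castRingHom ℂ) P =
      ∑ α ∈ P.support, ((coeff α P : ℤ) : ℂ) • monomial α (1 : ℂ) := by
    conv_lhs => rw [P.as_sum, map_sum]
    refine Finset.sum_congr rfl fun α _ => ?_
    rw [map_monomial, smul_monomial, smul_eq_mul, mul_one]
    rfl
  have hval : ε (ev (map (Int.castRingHom ℂ) P) (aeval c (map (Int.castRingHom ℂ) P) * q)) =
      (-1) ^ N * ε q *
        ((∑ α ∈ P.support, coeff α P ^ 2 * (∏ a, (α a).factorial : ℕ) : ℤ) : ℂ) := by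
    rw [hsum]
    simp only [map_sum, map_smul, LinearMap.sum_apply, LinearMap.smul_apply, Finset.sum_mul,
      smul_mul_assoc]
    have hdeg : ∀ α ∈ P.support, α.degree = N := fun α hα => by
      rw [Finsupp.degree_eq_weight_one]
      exact hP (mem_support_iff.1 hα)
    push_cast
    rw [Finset.mul_sum]
    refine Finset.sum_congr rfl fun α hα => ?_
    rw [Finset.sum_eq_single α]
    · rw [eval_monomial_mul ε W ev hev c hc hW α α le_rfl, if_pos rfl, hdeg α hα]
      simp only [smul_eq_mul]
      push_cast
      ring
    · intro β hβ hne
      rw [eval_monomial_mul ε W ev hev c hc hW _ _ (by rw [hdeg α hα, hdeg β hβ])]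
      simp [hne]
    · exact fun h => absurd hα h
  rw [hval]
  refine mul_ne_zero (mul_ne_zero (by simp) hq) (Int.cast_ne_zero.2 (ne_of_gt ?_))
  refine Finset.sum_pos (fun α hα => ?_) (Finset.nonempty_iff_ne_empty.2 (by simpa using hP0))
  have h1 : coeff α P ≠ 0 := mem_support_iff.1 hα
  have h2 : 0 < ∏ a, (α a).factorial := Finset.prod_pos fun a _ => Nat.factorial_pos _
  positivity

theorem isHomogeneous_det_mvPolynomialX (k : ℕ) :
    (Matrix.mvPolynomialX (Fin k) (Fin k) ℤ).det.IsHomogeneous k := by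
  rw [Matrix.det_apply]
  refine IsHomogeneous.sum _ _ _ fun σ _ => ?_
  have h : (∏ i, Matrix.mvPolynomialX (Fin k) (Fin k) ℤ (σ i) i).IsHomogeneous k := by
    have := IsHomogeneous.prod Finset.univ
      (fun i => Matrix.mvPolynomialX (Fin k) (Fin k) ℤ (σ i) i) (fun _ => 1)
      (fun i _ => by rw [Matrix.mvPolynomialX_apply]; exact isHomogeneous_X _ _)
    simpa using this
  rcases Int.units_eq_one_or (Equiv.Perm.sign σ) with hs | hs
  · rw [hs, one_smul]
    exact h
  · rw [hs, Units.neg_smul, one_smul]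
    exact h.neg

theorem genericDet_pow_eq_map (k i : ℕ) : genericDet k ^ i =
    map (Int.castRingHom ℂ) ((Matrix.mvPolynomialX (Fin k) (Fin k) ℤ).det ^ i) := by
  rw [map_pow, genericDet, RingHom.map_det]
  congr 2
  ext1 r s
  simp

end Pairing

/-! ### A test function in the source -/

section Witness

attribute [local instance] Matrix.normedAddCommGroup Matrix.normedSpace

section General

variable {n : Type} [Fintype n] [DecidableEq n]

/-- Evaluation of smooth functions at a point. -/
def evalAt (g : GL n ℂ) : smoothAlg n →ₐ[ℂ] ℂ :=
  (Pi.evalAlgHom ℂ (fun _ : GL n ℂ => ℂ) g).comp (smoothAlg n).val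

theorem evalAt_apply (g : GL n ℂ) (f : smoothAlg n) : evalAt g f = f.1 g := rfl

/-- The matrix entry in position `(I, J)`, composed with the real-linear map `σ`, as a real-linear
function on all matrices. -/
def entryCLM (σ : ℂ →ₐ[ℝ] ℂ) (I J : n) : Matrix n n ℂ →L[ℝ] ℂ :=
  LinearMap.toContinuousLinearMap (σ.toLinearMap ∘ₗ Matrix.entryLinearMap ℝ ℂ I J)

/-- The smooth function `g ↦ σ (g I J)` on `GL_n(ℂ)`. -/
def entry (σ : ℂ →ₐ[ℝ] ℂ) (I J : n) : smoothAlg n :=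
  ⟨fun g => σ (g.1 I J), isSmooth_of_eq (entryCLM σ I J) (entryCLM σ I J).contDiff.contDiffOn
    fun _ => rfl⟩

theorem entry_apply (σ : ℂ →ₐ[ℝ] ℂ) (I J : n) (g : GL n ℂ) :
    (entry σ I J).1 g = σ (g.1 I J) := rfl

theorem leftField_entry (σ : ℂ →ₐ[ℝ] ℂ) (X : Matrix n n ℂ) (I J : n) (g : GL n ℂ) :
    (leftField X (entry σ I J)).1 g = -σ ((X * g.1) I J) := by
  have h : ext (entry σ I J).1 =ᶠ[nhds g.1] entryCLM σ I J := by
    filter_upwards [isOpen_glSet.mem_nhds (mem_glSet g)]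
    rintro _ ⟨u, rfl⟩
    rw [ext_val]
    rfl
  rw [leftField_apply]
  exact congrArg (fun ℓ : Matrix n n ℂ →L[ℝ] ℂ => -ℓ (X * g.1))
    (h.fderiv_eq.trans (entryCLM σ I J).fderiv)

theorem wirtinger_entry (σ : ℂ →ₐ[ℝ] ℂ) (X : Matrix n n ℂ) (I J : n) (g : GL n ℂ) :
    (wirtinger σ X (entry σ I J)).1 g = -σ ((X * g.1) I J) := by
  change (1 / 2 : ℂ) * ((leftField X (entry σ I J)).1 g -
    σ Complex.I * (leftField (Complex.I • X) (entry σ I J)).1 g) = _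
  rw [leftField_entry, leftField_entry, Matrix.smul_mul, Matrix.smul_apply, smul_eq_mul, map_mul]
  linear_combination (1 / 2 * σ ((X * g.1) I J)) * algHom_I_mul_I σ

/-- The inverse of a smooth function without zeros. -/
def smoothInv (f : smoothAlg n) (hf : ∀ g, f.1 g ≠ 0) : smoothAlg n :=
  ⟨fun g => (f.1 g)⁻¹, isSmooth_of_eq (fun x => (ext f.1 x)⁻¹)
    (ContDiffOn.inv f.2 (by rintro _ ⟨u, rfl⟩; rw [ext_val]; exact hf u))
    fun g => by rw [ext_val]⟩

/-- The absolute value of a smooth function without zeros. -/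
def smoothNorm (f : smoothAlg n) (hf : ∀ g, f.1 g ≠ 0) : smoothAlg n :=
  ⟨fun g => (‖f.1 g‖ : ℝ), isSmooth_of_eq (fun x => ((‖ext f.1 x‖ : ℝ) : ℂ))
    (Complex.ofRealCLM.contDiff.comp_contDiffOn
      (ContDiffOn.norm ℝ f.2 (by rintro _ ⟨u, rfl⟩; rw [ext_val]; exact hf u)))
    fun g => by rw [ext_val]⟩

theorem evalAt_det {m : ℕ} (M : Matrix (Fin m) (Fin m) (smoothAlg n)) (g : GL n ℂ) :
    M.det.1 g = (M.map fun f => f.1 g).det :=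
  (evalAt g).map_det M

/-- The determinant, as a smooth function on `GL_n(ℂ)`. -/
def smoothDet (n : Type) [Fintype n] [DecidableEq n] : smoothAlg n :=
  (Matrix.of fun I J : n => entry (AlgHom.id ℝ ℂ) I J).det

theorem smoothDet_apply (g : GL n ℂ) : (smoothDet n).1 g = g.1.det :=
  (evalAt g).map_det _

theorem smoothDet_ne_zero (g : GL n ℂ) : (smoothDet n).1 g ≠ 0 := by
  rw [smoothDet_apply]
  exact ((Matrix.isUnit_iff_isUnit_det _).1 g.isUnit).ne_zero

end General

variable {k : ℕ} (σ : ℂ →ₐ[ℝ] ℂ)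

/-- The last `k` rows. -/
def bottomRows (x : Matrix (Fin k ⊕ Fin k) (Fin k ⊕ Fin k) ℂ) :
    Matrix (Fin k) (Fin k ⊕ Fin k) ℂ := x.submatrix Sum.inr id

theorem bottomRows_parabolicElt_mul (a d : GL (Fin k) ℂ) (b : Matrix (Fin k) (Fin k) ℂ)
    (x : GL (Fin k ⊕ Fin k) ℂ) :
    bottomRows (parabolicElt a b d * x).1 = d.val * bottomRows x.1 := by
  ext r J
  change (Matrix.fromBlocks a.val b 0 d.val * x.1) (Sum.inr r) J = _
  simp [Matrix.mul_apply, Fintype.sum_sum_type, bottomRows]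

/-- The Gram determinant of the last `k` rows, a positive function on `GL_{2k}(ℂ)`. -/
def gramDet (k : ℕ) : smoothAlg (Fin k ⊕ Fin k) :=
  (Matrix.of fun r s : Fin k => ∑ J, entry (AlgHom.id ℝ ℂ) (Sum.inr r) J *
    entry Complex.conjAe.toAlgHom (Sum.inr s) J).det

theorem gramDet_apply (x : GL (Fin k ⊕ Fin k) ℂ) :
    (gramDet k).1 x = (bottomRows x.1 * (bottomRows x.1).conjTranspose).det := by
  rw [gramDet, evalAt_det]
  congr 1
  ext r s
  rw [Matrix.map_apply, Matrix.of_apply, Matrix.mul_apply]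
  refine (map_sum (evalAt x) _ _).trans (Finset.sum_congr rfl fun J _ => ?_)
  rfl

open scoped ComplexOrder in
theorem gramDet_ne_zero (x : GL (Fin k ⊕ Fin k) ℂ) : (gramDet k).1 x ≠ 0 := by
  rw [gramDet_apply]
  refine (Matrix.PosDef.mul_conjTranspose_self _ fun v v' hv => ?_).det_pos.ne'
  -- The rows of an invertible matrix are linearly independent.
  have key : ∀ v : Fin k → ℂ, Matrix.vecMul v (bottomRows x.1) =
      Matrix.vecMul (Sum.elim 0 v) x.1 := by
    intro v
    ext J
    simp [Matrix.vecMul, dotProduct, Fintype.sum_sum_type, bottomRows]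
  simp only [key] at hv
  have := Matrix.vecMul_injective_of_isUnit x.isUnit hv
  funext r
  simpa using congrFun this (Sum.inr r)

/-- The determinant of the lower left block, composed with `σ`. -/
def lowerLeftDet : smoothAlg (Fin k ⊕ Fin k) :=
  MvPolynomial.aeval (fun a : Fin k × Fin k => entry σ (Sum.inr a.1) (Sum.inl a.2)) (genericDet k)

theorem lowerLeftDet_apply (x : GL (Fin k ⊕ Fin k) ℂ) :
    (lowerLeftDet σ).1 x = σ ((bottomRows x.1).submatrix id Sum.inl).det := by
  rw [lowerLeftDet, genericDet, AlgHom.map_det, evalAt_det, AlgHom.map_det]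
  congr 1
  ext r s
  simp [entry_apply, bottomRows]

/-- The determinant of the lower right block, composed with `σ`. -/
def lowerRightDet : smoothAlg (Fin k ⊕ Fin k) :=
  (Matrix.of fun r s : Fin k => entry σ (Sum.inr r) (Sum.inr s)).det

theorem lowerRightDet_apply (x : GL (Fin k ⊕ Fin k) ℂ) :
    (lowerRightDet σ).1 x = σ ((bottomRows x.1).submatrix id Sum.inr).det := by
  rw [lowerRightDet, evalAt_det, AlgHom.map_det]
  congr 1

/-- The factor of the test function `sourceWitness` that does not vanish at `1`. It transforms by
`δ̄(d)^j |det a|^k |det d|^{-k}`. For `j < 0` the power `δ̄(d)^j` is obtained as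
`δ(d)^{-j} |det d|^{2j}`, and the powers of `|det d|` come from the Gram determinant of the last `k`
rows, which has no zeros. -/
def sourceCofactor (j : ℤ) : smoothAlg (Fin k ⊕ Fin k) :=
  lowerRightDet (conjAlgHom σ) ^ j.toNat * lowerRightDet σ ^ (-j).toNat *
    smoothNorm (smoothDet _) smoothDet_ne_zero ^ k *
    smoothInv (gramDet k) gramDet_ne_zero ^ (k + (-j).toNat)

/-- A function in `1 × δ^i δ̄^j`, where `δ` is the composite of `σ` and the determinant. On the
opposite nilradical it is `δ(z)^i` times a function which is `1` at the origin. -/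
def sourceWitness (i : ℕ) (j : ℤ) : smoothAlg (Fin k ⊕ Fin k) :=
  lowerLeftDet σ ^ i * sourceCofactor σ j

theorem sourceWitness_apply (i : ℕ) (j : ℤ) (x : GL (Fin k ⊕ Fin k) ℂ) :
    (sourceWitness σ i j).1 x = (lowerLeftDet σ).1 x ^ i *
      ((lowerRightDet (conjAlgHom σ)).1 x ^ j.toNat * (lowerRightDet σ).1 x ^ (-j).toNat *
        ((‖x.1.det‖ : ℝ) : ℂ) ^ k * ((gramDet k).1 x)⁻¹ ^ (k + (-j).toNat)) := by
  rw [← smoothDet_apply]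
  rfl

theorem algHom_mul_conj (c : ℂ) : σ c * starRingEnd ℂ (σ c) = ((‖c‖ : ℝ) : ℂ) ^ 2 := by
  rw [← Complex.mul_conj', algHom_eq σ c, map_add, map_mul]
  have hconj : starRingEnd ℂ (σ Complex.I) = -σ Complex.I := conjAlgHom_I σ
  rw [hconj, Complex.conj_ofReal, Complex.conj_ofReal, Complex.mul_conj, Complex.normSq_apply]
  push_cast
  linear_combination (-(c.im : ℂ) ^ 2) * algHom_I_mul_I σ

theorem sqrt_modular (a d : GL (Fin k) ℂ) :
    √(modular a d) = ‖a.val.det‖ ^ k * (‖d.val.det‖ ^ k)⁻¹ := by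
  have h : modular a d = (‖a.val.det‖ ^ k * (‖d.val.det‖ ^ k)⁻¹) ^ 2 := by
    change (‖a.val.det‖ ^ 2) ^ k * ((‖d.val.det‖ ^ 2) ^ k)⁻¹ = _
    rw [mul_pow, inv_pow, ← pow_mul, ← pow_mul, ← pow_mul, ← pow_mul, mul_comm 2 k]
  rw [h, Real.sqrt_sq (by positivity)]

theorem isEquivariant_sourceWitness (i : ℕ) (j : ℤ) :
    IsEquivariant (sourceFactor σ i j) (sourceWitness (k := k) σ i j).1 := by
  intro a b d x
  have hdet : (parabolicElt a b d * x).1.det = a.val.det * d.val.det * x.1.det := by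
    rw [Units.val_mul, Matrix.det_mul]
    congr 1
    exact Matrix.det_fromBlocks_zero₂₁ _ _ _
  have hgram : (gramDet k).1 (parabolicElt a b d * x) =
      ((‖d.val.det‖ : ℝ) : ℂ) ^ 2 * (gramDet k).1 x := by
    rw [gramDet_apply, gramDet_apply, bottomRows_parabolicElt_mul, Matrix.conjTranspose_mul,
      Matrix.mul_assoc, Matrix.det_mul, ← Matrix.mul_assoc (bottomRows x.1), Matrix.det_mul,
      Matrix.det_conjTranspose, ← Complex.mul_conj']
    change _ * (_ * starRingEnd ℂ _) = _
    ring
  have hL : ∀ τ : ℂ →ₐ[ℝ] ℂ, (lowerLeftDet τ).1 (parabolicElt a b d * x) =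
      τ d.val.det * (lowerLeftDet τ).1 x := by
    intro τ
    rw [lowerLeftDet_apply, lowerLeftDet_apply, bottomRows_parabolicElt_mul, ← map_mul,
      ← Matrix.det_mul]
    rfl
  have hR : ∀ τ : ℂ →ₐ[ℝ] ℂ, (lowerRightDet τ).1 (parabolicElt a b d * x) =
      τ d.val.det * (lowerRightDet τ).1 x := by
    intro τ
    rw [lowerRightDet_apply, lowerRightDet_apply, bottomRows_parabolicElt_mul, ← map_mul,
      ← Matrix.det_mul]
    rfl
  have hd0 : d.val.det ≠ 0 := ((Matrix.isUnit_iff_isUnit_det _).1 d.isUnit).ne_zero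
  have hσd : σ d.val.det ≠ 0 := (map_ne_zero σ).2 hd0
  have hσd' : starRingEnd ℂ (σ d.val.det) ≠ 0 := (map_ne_zero _).2 hσd
  have hn : ((‖d.val.det‖ : ℝ) : ℂ) ≠ 0 := by simpa using hd0
  have hzpow : (starRingEnd ℂ (σ d.val.det)) ^ j =
      (starRingEnd ℂ (σ d.val.det)) ^ j.toNat * ((starRingEnd ℂ (σ d.val.det)) ^ (-j).toNat)⁻¹ := by
    conv_lhs => rw [show j = (j.toNat : ℤ) - ((-j).toNat : ℤ) by omega]
    rw [zpow_sub₀ hσd', zpow_natCast, zpow_natCast, div_eq_mul_inv]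
  rw [sourceWitness_apply, sourceWitness_apply, hdet, hgram, hL, hR, hR, sourceFactor, sqrt_modular,
    hzpow, norm_mul, norm_mul, conjAlgHom_apply]
  have hG := gramDet_ne_zero x
  have hm := algHom_mul_conj σ d.val.det
  generalize hN : ((‖d.val.det‖ : ℝ) : ℂ) = N at *
  generalize σ d.val.det = u at *
  generalize starRingEnd ℂ u = u' at *
  push_cast
  rw [hN, pow_add, pow_add]
  have e1 : (N ^ 2 * (gramDet k).1 x)⁻¹ ^ (-j).toNat =
      (u ^ (-j).toNat)⁻¹ * (u' ^ (-j).toNat)⁻¹ * ((gramDet k).1 x)⁻¹ ^ (-j).toNat := by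
    rw [← hm, mul_inv, mul_pow, mul_inv, mul_pow, inv_pow, inv_pow]
  have e2 : (N ^ 2 * (gramDet k).1 x)⁻¹ ^ k =
      (N ^ k)⁻¹ * (N ^ k)⁻¹ * ((gramDet k).1 x)⁻¹ ^ k := by
    rw [sq, mul_inv, mul_pow, mul_inv, mul_pow, inv_pow]
  rw [e1, e2]
  simp only [mul_pow]
  field_simp

theorem sourceCofactor_apply_one (j : ℤ) : (sourceCofactor (k := k) σ j).1 1 = 1 := by
  have hb : bottomRows (1 : GL (Fin k ⊕ Fin k) ℂ).1 *
      (bottomRows (1 : GL (Fin k ⊕ Fin k) ℂ).1).conjTranspose = 1 := by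
    ext r s
    simp [bottomRows, Matrix.mul_apply, Matrix.one_apply]
  have hs : ((bottomRows (1 : GL (Fin k ⊕ Fin k) ℂ).1).submatrix id Sum.inr).det = 1 := by
    rw [← Matrix.det_one (n := Fin k) (R := ℂ)]
    congr 1
    ext r s
    simp [bottomRows, Matrix.one_apply]
  change (lowerRightDet (conjAlgHom σ)).1 1 ^ j.toNat * (lowerRightDet σ).1 1 ^ (-j).toNat *
    ((‖(smoothDet (Fin k ⊕ Fin k)).1 1‖ : ℝ) : ℂ) ^ k * ((gramDet k).1 1)⁻¹ ^ (k + (-j).toNat) = 1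
  rw [smoothDet_apply, gramDet_apply, hb, lowerRightDet_apply, lowerRightDet_apply, hs]
  simp

theorem lowerAlg_sourceWitness_ne_zero (i : ℕ) (j : ℤ) :
    (lowerAlg σ (genericDet k ^ i) (sourceWitness σ i j)).1 1 ≠ 0 := by
  have h := eval_self_ne_zero (evalAt (1 : GL (Fin k ⊕ Fin k) ℂ))
    (fun a : Fin k × Fin k => wirtinger σ (Matrix.single (Sum.inr a.1) (Sum.inl a.2) 1))
    (lowerAlg σ) (fun a x => by rw [lowerAlg_X]; rfl)
    (fun a => entry σ (Sum.inr a.1) (Sum.inl a.2))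
    (fun a => by rw [evalAt_apply, entry_apply]; simp)
    (fun a b => by
      rw [evalAt_apply, wirtinger_entry]
      by_cases hab : a = b
      · subst hab
        simp
      · have : ¬(a.1 = b.1 ∧ a.2 = b.2) := fun h => hab (Prod.ext h.1 h.2)
        simp [hab, this])
    ((Matrix.mvPolynomialX (Fin k) (Fin k) ℤ).det ^ i)
    ((isHomogeneous_det_mvPolynomialX k).pow i)
    (pow_ne_zero _ (Matrix.det_mvPolynomialX_ne_zero (Fin k) ℤ))
    (sourceCofactor σ j)
    (by rw [evalAt_apply, sourceCofactor_apply_one]; exact one_ne_zero)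
  rw [← genericDet_pow_eq_map, map_pow (MvPolynomial.aeval _)] at h
  exact h

end Witness

/-! ### The intertwining operators -/

section Intertwining

attribute [local instance] Matrix.normedAddCommGroup Matrix.normedSpace

variable {k : ℕ} (σ : ℂ →ₐ[ℝ] ℂ)

theorem leftDeriv_eq_leftField (z : Matrix (Fin k) (Fin k) ℂ) (f : smoothAlg (Fin k ⊕ Fin k))
    (x : GL (Fin k ⊕ Fin k) ℂ) :
    leftDeriv z f.1 x = (leftField (Matrix.fromBlocks 0 0 z 0) f).1 x := by
  set X : Matrix (Fin k ⊕ Fin k) (Fin k ⊕ Fin k) ℂ := Matrix.fromBlocks 0 0 z 0 with hX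
  have h := hasDerivAt_leftField X f x (by simp) (hasDerivAt_sub_smul x.1 (X * x.1) 0)
  have hcurve : ∀ t : ℝ, f.1 (lowerElt (-(t • z)) * x) = ext f.1 (x.1 - t • (X * x.1)) := by
    intro t
    have hp : (lowerElt (-(t • z))).1 = 1 - (t : ℂ) • X := by
      change Matrix.fromBlocks 1 0 (-(t • z)) 1 = _
      rw [hX, Matrix.fromBlocks_smul, one_sub_fromBlocks]
      simp
    have hx : (lowerElt (-(t • z)) * x).1 = x.1 - t • (X * x.1) := by
      rw [Units.val_mul, hp, sub_mul, one_mul, Matrix.smul_mul]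
      rfl
    rw [← hx, ext_val]
  rw [leftDeriv]
  simp only [hcurve]
  exact h.deriv

theorem unitField_lower_apply (r s : Fin k) (f : smoothAlg (Fin k ⊕ Fin k))
    (x : GL (Fin k ⊕ Fin k) ℂ) :
    (unitField σ (Sum.inr r) (Sum.inl s) f).1 x = (leftDeriv (Matrix.single r s 1) f.1 x
      - σ Complex.I * leftDeriv (Matrix.single r s Complex.I) f.1 x) / 2 := by
  rw [leftDeriv_eq_leftField, leftDeriv_eq_leftField, ← single_inr_inl, ← single_inr_inl,
    unitField_apply, wirtinger_def, Matrix.smul_single, smul_eq_mul, mul_one]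
  exact (div_eq_inv_mul _ _).trans (congrArg (· * _) (one_div (2 : ℂ)).symm) |>.symm

theorem leftWirtinger_eq_unitField (r s : Fin k) (f : smoothAlg (Fin k ⊕ Fin k)) :
    leftWirtinger r s f.1 = (unitField (AlgHom.id ℝ ℂ) (Sum.inr r) (Sum.inl s) f).1 :=
  funext fun x => (unitField_lower_apply (AlgHom.id ℝ ℂ) r s f x).symm

theorem leftWirtingerBar_eq_unitField (r s : Fin k) (f : smoothAlg (Fin k ⊕ Fin k)) :
    leftWirtingerBar r s f.1 =
      (unitField Complex.conjAe.toAlgHom (Sum.inr r) (Sum.inl s) f).1 := by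
  refine funext fun x => ?_
  have hI : (Complex.conjAe.toAlgHom : ℂ →ₐ[ℝ] ℂ) Complex.I = -Complex.I := Complex.conj_I
  rw [unitField_lower_apply, hI, neg_mul, sub_neg_eq_add]
  rfl

theorem detOp_eq_lowerAlg
    {D : Fin k → Fin k → (GL (Fin k ⊕ Fin k) ℂ → ℂ) → (GL (Fin k ⊕ Fin k) ℂ → ℂ)}
    (hD : ∀ r s (f : smoothAlg (Fin k ⊕ Fin k)),
      D r s f.1 = (unitField σ (Sum.inr r) (Sum.inl s) f).1)
    (f : smoothAlg (Fin k ⊕ Fin k)) :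
    detOp D f.1 = (lowerAlg σ (genericDet k) f).1 := by
  have hfold : ∀ (τ : Equiv.Perm (Fin k)) (l : List (Fin k)),
      l.foldr (fun s h => D (τ s) s h) f.1 =
        (lowerAlg σ (l.map fun s => MvPolynomial.X (τ s, s)).prod f).1 := by
    intro τ l
    induction l with
    | nil => simp
    | cons s l ih =>
      rw [List.foldr_cons, ih, hD, List.map_cons, List.prod_cons, map_mul, Module.End.mul_apply,
        lowerAlg_X]
  funext x
  rw [detOp, genericDet, Matrix.det_apply, map_sum, LinearMap.sum_apply]
  refine Eq.trans ?_ (map_sum (evalAt x) _ _).symm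
  refine Finset.sum_congr rfl fun τ _ => ?_
  rw [hfold, evalAt_apply, Units.smul_def, map_zsmul, LinearMap.smul_apply]
  simp only [Matrix.mvPolynomialX_apply, Fin.prod_univ_def]
  rw [← zsmul_eq_mul]
  rfl

theorem iterate_detOp_eq_lowerAlg
    {D : Fin k → Fin k → (GL (Fin k ⊕ Fin k) ℂ → ℂ) → (GL (Fin k ⊕ Fin k) ℂ → ℂ)}
    (hD : ∀ r s (f : smoothAlg (Fin k ⊕ Fin k)),
      D r s f.1 = (unitField σ (Sum.inr r) (Sum.inl s) f).1)
    (i : ℕ) (f : smoothAlg (Fin k ⊕ Fin k)) :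
    (detOp D)^[i] f.1 = (lowerAlg σ (genericDet k ^ i) f).1 := by
  induction i with
  | zero => simp
  | succ i ih =>
    rw [Function.iterate_succ_apply', ih, detOp_eq_lowerAlg σ hD, pow_succ', map_mul,
      Module.End.mul_apply]

/-- Right translation by `g`: `f` becomes `x ↦ f (x g)`. -/
def translateRight (g : GL (Fin k ⊕ Fin k) ℂ) : Module.End ℂ (smoothAlg (Fin k ⊕ Fin k)) where
  toFun f := ⟨fun x => f.1 (x * g), IsSmooth.translate f.2 g⟩
  map_add' _ _ := rfl
  map_smul' _ _ := rfl

theorem translateRight_leftField (g : GL (Fin k ⊕ Fin k) ℂ)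
    (X : Matrix (Fin k ⊕ Fin k) (Fin k ⊕ Fin k) ℂ) (f : smoothAlg (Fin k ⊕ Fin k)) :
    translateRight g (leftField X f) = leftField X (translateRight g f) := by
  refine smoothAlg_ext fun x => ?_
  have h1 := hasDerivAt_leftField X f (x * g) (by simp)
    (hasDerivAt_sub_smul (x * g : GL _ ℂ).1 (X * (x * g : GL _ ℂ).1) 0)
  have h2 := hasDerivAt_leftField X (translateRight g f) x (by simp)
    (hasDerivAt_sub_smul x.1 (X * x.1) 0)
  refine h1.unique (h2.congr_of_eventuallyEq (Filter.Eventually.of_forall fun t => ?_))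
  have he : ext (translateRight g f).1 = fun y => ext f.1 (y * g.1) := ext_translate f.1 g
  change _ = ext (translateRight g f).1 (x.1 - t • (X * x.1))
  rw [he]
  change ext f.1 _ = ext f.1 _
  rw [Units.val_mul, sub_mul, Matrix.smul_mul, Matrix.mul_assoc]

theorem translateRight_lowerAlg (P : MvPolynomial (Fin k × Fin k) ℂ)
    (g : GL (Fin k ⊕ Fin k) ℂ) (f : smoothAlg (Fin k ⊕ Fin k)) :
    translateRight g (lowerAlg σ P f) = lowerAlg σ P (translateRight g f) := by
  have h := commutator_aeval (lowerAlg (k := k) σ) (translateRight g) 0 (by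
    intro a
    rw [Derivation.zero_apply, map_zero, add_zero, lowerAlg_X]
    refine LinearMap.ext fun f => ?_
    simp only [Module.End.mul_apply, unitField_apply, wirtinger_def, map_smul, map_sub,
      translateRight_leftField]) P
  rw [Derivation.zero_apply, map_zero, add_zero] at h
  exact LinearMap.congr_fun h f

/-- The form of the result common to both operators: `D` is the family of Wirtinger derivatives for
`σ`, and the characters are only known through their values. -/
theorem exists_intertwining
    {D : Fin k → Fin k → (GL (Fin k ⊕ Fin k) ℂ → ℂ) → (GL (Fin k ⊕ Fin k) ℂ → ℂ)}
    (hD : ∀ r s (f : smoothAlg (Fin k ⊕ Fin k)),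
      D r s f.1 = (unitField σ (Sum.inr r) (Sum.inl s) f).1)
    (i : ℕ) (j : ℤ) (χ₁ χ₂ ψ₁ ψ₂ : GL (Fin k) ℂ →* ℂˣ)
    (hχ : ∀ a d, (χ₁ a : ℂ) * (χ₂ d : ℂ) * (√(modular a d) : ℝ) = sourceFactor σ i j a d)
    (hψ : ∀ a d, (ψ₁ a : ℂ) * (ψ₂ d : ℂ) * (√(modular a d) : ℝ) = targetFactor σ i j a d) :
    ∃ T : inducedSpace χ₁ χ₂ →L[ℂ] inducedSpace ψ₁ ψ₂, T ≠ 0 ∧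
      Representation.IsIntertwiningMap (induced χ₁ χ₂) (induced ψ₁ ψ₂) T.toLinearMap ∧
      ∀ f, ∀ x : GL (Fin k ⊕ Fin k) ℂ, (T f).1 x = ((detOp D)^[i] f.1) x := by
  let A := lowerAlg σ (genericDet k ^ i)
  have hA : IsLocallyBounded A := IsLocallyBounded.aeval _
    (fun a => by rw [lowerAlg_X]; exact isLocallyBounded_wirtinger _ _) _
  have hmem : ∀ f : inducedSpace χ₁ χ₂,
      (show SmoothFun (Fin k ⊕ Fin k) from A (show smoothAlg (Fin k ⊕ Fin k) from f.1)) ∈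
        inducedSpace ψ₁ ψ₂ := by
    intro f a b d x
    have hf : IsEquivariant (sourceFactor σ i j) f.1.1 := fun a b d x => by
      rw [← hχ]
      exact f.2 a b d x
    rw [hψ]
    exact isEquivariant_lowerAlg σ (show smoothAlg (Fin k ⊕ Fin k) from f.1) hf a b d x
  let T : inducedSpace χ₁ χ₂ →L[ℂ] inducedSpace ψ₁ ψ₂ :=
    { toFun := fun f => ⟨_, hmem f⟩
      map_add' := fun f g => Subtype.ext (map_add A _ _)
      map_smul' := fun c f => Subtype.ext (map_smul A c _)
      cont := (hA.continuous.comp continuous_subtype_val).subtype_mk _ }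
  have hT : ∀ f, ∀ x : GL (Fin k ⊕ Fin k) ℂ, (T f).1 x = ((detOp D)^[i] f.1) x := fun f x =>
    (congrFun (iterate_detOp_eq_lowerAlg σ hD i (show smoothAlg (Fin k ⊕ Fin k) from f.1)) x).symm
  refine ⟨T, fun h0 => ?_, ⟨?_⟩, hT⟩
  · let f : inducedSpace χ₁ χ₂ := ⟨sourceWitness σ i j, fun a b d x => by
      rw [hχ]
      exact isEquivariant_sourceWitness σ i j a b d x⟩
    refine lowerAlg_sourceWitness_ne_zero (k := k) σ i j ?_
    change (T f).1 1 = 0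
    rw [h0]
    rfl
  · intro g f
    refine Subtype.ext ?_
    exact (translateRight_lowerAlg σ (genericDet k ^ i) g
      (show smoothAlg (Fin k ⊕ Fin k) from f.1)).symm

end Intertwining

end LineBundleGr

end

open LineBundleGr in
theorem proposition1p5 (k : ℕ) (hk : 0 < k) (i : ℕ) (hi : 0 < i) (j : ℤ) :
    (∃ T : inducedSpace (1 : GL (Fin k) ℂ →* ℂˣ) (detChar k ^ i * detBarChar k ^ j) →L[ℂ]
          inducedSpace (detChar k ^ i) (detBarChar k ^ j),
        T ≠ 0 ∧
        Representation.IsIntertwiningMap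
          (induced (1 : GL (Fin k) ℂ →* ℂˣ) (detChar k ^ i * detBarChar k ^ j))
          (induced (detChar k ^ i) (detBarChar k ^ j)) T.toLinearMap ∧
        ∀ f, ∀ x : GL (Fin k ⊕ Fin k) ℂ, (T f).1 x = (leftDet^[i] f.1) x) ∧
    (∃ T : inducedSpace (1 : GL (Fin k) ℂ →* ℂˣ) (detBarChar k ^ i * detChar k ^ j) →L[ℂ]
          inducedSpace (detBarChar k ^ i) (detChar k ^ j),
        T ≠ 0 ∧
        Representation.IsIntertwiningMap
          (induced (1 : GL (Fin k) ℂ →* ℂˣ) (detBarChar k ^ i * detChar k ^ j))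
          (induced (detBarChar k ^ i) (detChar k ^ j)) T.toLinearMap ∧
        ∀ f, ∀ x : GL (Fin k ⊕ Fin k) ℂ, (T f).1 x = (leftDetBar^[i] f.1) x) := by
  have hval : ∀ d : GL (Fin k) ℂ, ((detChar k d : ℂˣ) : ℂ) = d.val.det := fun _ => rfl
  have hbar : ∀ d : GL (Fin k) ℂ, ((detBarChar k d : ℂˣ) : ℂ) = starRingEnd ℂ d.val.det :=
    fun _ => rfl
  have hconj : ∀ c : ℂ, (Complex.conjAe.toAlgHom : ℂ →ₐ[ℝ] ℂ) c = starRingEnd ℂ c := fun _ => rfl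
  constructor
  · refine exists_intertwining (AlgHom.id ℝ ℂ) leftWirtinger_eq_unitField i j _ _ _ _ ?_ ?_
    · intro a d
      simp [sourceFactor, hval, hbar, MonoidHom.zpow_apply]
    · intro a d
      simp [targetFactor, hval, hbar, MonoidHom.zpow_apply]
  · refine exists_intertwining Complex.conjAe.toAlgHom leftWirtingerBar_eq_unitField i j _ _ _ _
      ?_ ?_
    · intro a d
      rw [sourceFactor, hconj, Complex.conj_conj]
      simp [hval, hbar, MonoidHom.zpow_apply]
    · intro a d
      rw [targetFactor, hconj, hconj, Complex.conj_conj]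
      simp [hval, hbar, MonoidHom.zpow_apply]
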